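/- Let $\mathfrak g$ be a finite-dimensional semisimple Lie algebra over $\mathbb C$, $\mathfrak h\subset\mathfrak b\subset\mathfrak g$ a Cartan subalgebra and a Borel subalgebra containing it, and $\Gamma\subset\mathfrak h^*$ the corresponding set of simple roots. Let $G$ be the adjoint group of $\mathfrak g$ (the group of inner automorphisms of $\mathfrak g$) and $B\subset G$ the Borel subgroup with Lie algebra $\mathfrak b$. Let $\mathfrak g=\bigoplus_k\mathfrak g_k$ be the Lie algebra grading with $\mathfrak g_0=\mathfrak h$, $\mathfrak g_{\pm1}=\bigoplus_{\alpha\in\Gamma}\mathfrak g^{\pm\alpha}$, and put $\mathfrak g^k=\bigoplus_{r\ge k}\mathfrak g_r$. Let $Y$ be a smooth algebraic curve over $\mathbb C$ with tangent sheaf $\Theta$. For a $B$-bundle $\mathcal F$ on $Y$ let $\mathcal E_{\mathcal F}$ be the algebroid of infinitesimal symmetries of $\mathcal F$, let $\mathcal E^{\mathfrak g}_{\mathcal F}$ be the algebroid of infinitesimal symmetries of the induced $G$-bundle $\mathcal F\times^B G$, and let $\mathcal E^{-1}_{\mathcal F}\subset\mathcal E^{\mathfrak g}_{\mathcal F}$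 be the preimage of $\mathfrak g^{-1}_{\mathcal F}/\mathfrak b_{\mathcal F}\subset\mathfrak g_{\mathcal F}/\mathfrak b_{\mathcal F}=\mathcal E^{\mathfrak g}_{\mathcal F}/\mathcal E_{\mathcal F}$, where the subscript $\mathcal F$ denotes the $\mathcal F$-twist of a $B$-module; thus $\mathcal E^{-1}_{\mathcal F}/\mathcal E_{\mathcal F}=\bigoplus_{\alpha\in\Gamma}\mathfrak g^{-\alpha}_{\mathcal F}$. A $\mathfrak g$-oper on $Y$ is a $B$-bundle $\mathcal F$ on $Y$ together with a connection $\nabla$ on $\mathcal F\times^B G$, i.e. an $\mathcal O_Y$-linear splitting $\nabla:\Theta\to\mathcal E^{\mathfrak g}_{\mathcal F}$ of the anchor map, such that $\nabla(\Theta)\subset\mathcal E^{-1}_{\mathcal F}$ and for every $\alpha\in\Gamma$ the composition $\Theta\to\mathcal E^{-1}_{\mathcal F}\to\mathcal E^{-1}_{\mathcal F}/\mathcal E_{\mathcal F}\to\mathfrak g^{-\alpha}_{\mathcal F}$ is an isomorphism. An automorphism of $(\mathcal F,\nabla)$ is an automorphism of the $B$-bundle $\mathcal F$ whose induced action on $\mathcal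 F\times^B G$ preserves $\nabla$. Proposition. Every automorphism of a $\mathfrak g$-oper $(\mathcal F,\nabla)$ on $Y$ is the identity. -/

import Mathlib

open CategoryTheory AlgebraicGeometry TopologicalSpace Opposite
open scoped TensorProduct

namespace Opers

noncomputable section

/-! ### Linear algebraic groups inside `GL(𝔤)` and their points -/

section Points

variable {𝔤 : Type*} [AddCommGroup 𝔤] [Module ℂ 𝔤]
variable (R : Type*) [CommRing R] [Algebra ℂ R]
variable {R' : Type*} [CommRing R'] [Algebra ℂ R']

/-- Indices for the generators of the coordinate ring of `GL(𝔤)`: the matrix coefficients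
`φ ↦ ⟨l, φ x⟩` (left summand) and `φ ↦ ⟨l, φ⁻¹ x⟩` (right summand). -/
abbrev Coord (𝔤 : Type*) [AddCommGroup 𝔤] [Module ℂ 𝔤] : Type _ :=
  (𝔤 × Module.Dual ℂ 𝔤) ⊕ (𝔤 × Module.Dual ℂ 𝔤)

/-- The `R`-linear extension `R ⊗ 𝔤 → R` of a linear form on `𝔤`. -/
def dualExt (l : Module.Dual ℂ 𝔤) : R ⊗[ℂ] 𝔤 →ₗ[R] R :=
  LinearMap.liftBaseChange R ((Algebra.linearMap ℂ R) ∘ₗ l)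

/-- Matrix coefficients of a `ℂ`-point of `GL(𝔤)`. -/
def coordC (σ : LinearMap.GeneralLinearGroup ℂ 𝔤) : Coord 𝔤 → ℂ
  | .inl (x, l) => l (σ.1 x)
  | .inr (x, l) => l (σ⁻¹.1 x)

/-- Matrix coefficients of an `R`-point of `GL(𝔤)`. -/
def coord (φ : LinearMap.GeneralLinearGroup R (R ⊗[ℂ] 𝔤)) : Coord 𝔤 → R
  | .inl (x, l) => dualExt R l (φ.1 (1 ⊗ₜ x))
  | .inr (x, l) => dualExt R l (φ⁻¹.1 (1 ⊗ₜ x))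

variable {R} in
/-- The extension `R ⊗ 𝔤 → R' ⊗ 𝔤` of a homomorphism `R → R'`. -/
def extMap (𝔤 : Type*) [AddCommGroup 𝔤] [Module ℂ 𝔤] (ρ : R →ₐ[ℂ] R') :
    R ⊗[ℂ] 𝔤 →ₗ[ℂ] R' ⊗[ℂ] 𝔤 :=
  LinearMap.rTensor 𝔤 ρ.toLinearMap

variable {R}

@[simp] lemma dualExt_tmul (l : Module.Dual ℂ 𝔤) (r : R) (x : 𝔤) :
    dualExt R l (r ⊗ₜ x) = r * algebraMap ℂ R (l x) := by
  simp [dualExt]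

@[simp] lemma extMap_tmul (ρ : R →ₐ[ℂ] R') (r : R) (x : 𝔤) :
    extMap 𝔤 ρ (r ⊗ₜ x) = ρ r ⊗ₜ x := by
  simp [extMap]

lemma extMap_smul (ρ : R →ₐ[ℂ] R') (r : R) (y : R ⊗[ℂ] 𝔤) :
    extMap 𝔤 ρ (r • y) = ρ r • extMap 𝔤 ρ y := by
  induction y with
  | zero => simp
  | tmul a x => simp [TensorProduct.smul_tmul']
  | add y z hy hz => simp [smul_add, hy, hz]

lemma dualExt_extMap (ρ : R →ₐ[ℂ] R') (l : Module.Dual ℂ 𝔤) (y : R ⊗[ℂ] 𝔤) :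
    dualExt R' l (extMap 𝔤 ρ y) = ρ (dualExt R l y) := by
  induction y with
  | zero => simp
  | tmul a x => simp
  | add y z hy hz => simp [hy, hz]

/-- The extension of scalars of an `R`-linear endomorphism of `R ⊗ 𝔤` along `R → R'`. -/
def endExt (ρ : R →ₐ[ℂ] R') (φ : Module.End R (R ⊗[ℂ] 𝔤)) : Module.End R' (R' ⊗[ℂ] 𝔤) :=
  LinearMap.liftBaseChange R'
    (extMap 𝔤 ρ ∘ₗ φ.restrictScalars ℂ ∘ₗ TensorProduct.mk ℂ R 𝔤 1)

@[simp] lemma endExt_tmul (ρ : R →ₐ[ℂ] R') (φ : Module.End R (R ⊗[ℂ] 𝔤)) (r : R') (x : 𝔤) :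
    endExt ρ φ (r ⊗ₜ x) = r • extMap 𝔤 ρ (φ (1 ⊗ₜ x)) := by
  simp [endExt]

lemma endExt_extMap (ρ : R →ₐ[ℂ] R') (φ : Module.End R (R ⊗[ℂ] 𝔤)) (y : R ⊗[ℂ] 𝔤) :
    endExt ρ φ (extMap 𝔤 ρ y) = extMap 𝔤 ρ (φ y) := by
  induction y with
  | zero => simp
  | tmul a x =>
    have : (a ⊗ₜ[ℂ] x : R ⊗[ℂ] 𝔤) = a • ((1 : R) ⊗ₜ[ℂ] x) := by simp [TensorProduct.smul_tmul']
    rw [this, extMap_smul, LinearMap.map_smul φ, extMap_smul, LinearMap.map_smul (endExt ρ φ)]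
    simp
  | add y z hy hz => simp [hy, hz]

/-- Restriction of points `GL(R ⊗ 𝔤) → GL(R' ⊗ 𝔤)` along `R → R'`. -/
def glExt (𝔤 : Type*) [AddCommGroup 𝔤] [Module ℂ 𝔤] (ρ : R →ₐ[ℂ] R') :
    LinearMap.GeneralLinearGroup R (R ⊗[ℂ] 𝔤) →*
      LinearMap.GeneralLinearGroup R' (R' ⊗[ℂ] 𝔤) :=
  Units.map
    { toFun := endExt ρ
      map_one' := by
        ext x
        simp
      map_mul' := fun φ ψ => by
        ext x
        simp [endExt_extMap] }

@[simp] lemma glExt_val (ρ : R →ₐ[ℂ] R') (φ : LinearMap.GeneralLinearGroup R (R ⊗[ℂ] 𝔤)) :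
    (glExt 𝔤 ρ φ).1 = endExt ρ φ.1 := rfl

@[simp] lemma glExt_inv_val (ρ : R →ₐ[ℂ] R') (φ : LinearMap.GeneralLinearGroup R (R ⊗[ℂ] 𝔤)) :
    (glExt 𝔤 ρ φ)⁻¹.1 = endExt ρ φ⁻¹.1 := rfl

lemma coord_glExt (ρ : R →ₐ[ℂ] R') (φ : LinearMap.GeneralLinearGroup R (R ⊗[ℂ] 𝔤))
    (c : Coord 𝔤) : coord R' (glExt 𝔤 ρ φ) c = ρ (coord R φ c) := by
  rcases c with ⟨x, l⟩ | ⟨x, l⟩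
  · simp only [coord, glExt_val, endExt_tmul, one_smul, dualExt_extMap]
  · simp only [coord, glExt_inv_val, endExt_tmul, one_smul, dualExt_extMap]

/-- The polynomial `f` in the generators of the coordinate ring of `GL(𝔤)` vanishes on `S`. -/
def VanishesOn (S : Subgroup (LinearMap.GeneralLinearGroup ℂ 𝔤))
    (f : MvPolynomial (Coord 𝔤) ℂ) : Prop :=
  ∀ σ ∈ S, MvPolynomial.aeval (coordC σ) f = 0

/-- A polynomial with coefficients in `R` that vanishes on `S` vanishes on every `R`-point. -/
lemma eval_eq_zero_of_vanishes (S : Subgroup (LinearMap.GeneralLinearGroup ℂ 𝔤))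
    (v : Coord 𝔤 → R)
    (hv : ∀ f, VanishesOn S f → MvPolynomial.aeval v f = 0)
    (F : MvPolynomial (Coord 𝔤) R)
    (hF : ∀ σ ∈ S, MvPolynomial.eval (fun c => algebraMap ℂ R (coordC σ c)) F = 0) :
    MvPolynomial.eval v F = 0 := by
  classical
  let b := Module.Basis.ofVectorSpace ℂ R
  let Fi : Module.Basis.ofVectorSpaceIndex ℂ R → MvPolynomial (Coord 𝔤) ℂ := fun i =>
    ∑ m ∈ F.support, MvPolynomial.monomial m (b.repr (F.coeff m) i)
  have hFi : ∀ i, VanishesOn S (Fi i) := by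
    intro i σ hσ
    have h := hF σ hσ
    rw [MvPolynomial.eval_eq] at h
    have h2 := congrArg (fun r => b.repr r i) h
    simp only [map_sum, Finsupp.coe_finsetSum, Finset.sum_apply, map_zero,
      Finsupp.coe_zero, Pi.zero_apply] at h2
    simp only [Fi, map_sum, MvPolynomial.aeval_monomial]
    rw [← h2]
    refine Finset.sum_congr rfl fun m _ => ?_
    have h3 : F.coeff m * ∏ c ∈ m.support, algebraMap ℂ R (coordC σ c) ^ m c =
        (∏ c ∈ m.support, coordC σ c ^ m c) • F.coeff m := by
      rw [Algebra.smul_def, map_prod, mul_comm]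
      simp
    rw [h3, map_smul]
    simp [Finsupp.prod, mul_comm]
  have hz := fun i => hv (Fi i) (hFi i)
  rw [MvPolynomial.eval_eq]
  have key : ∀ m ∈ F.support, F.coeff m * ∏ c ∈ m.support, v c ^ m c =
      ∑ i ∈ F.support.biUnion (fun m => (b.repr (F.coeff m)).support),
        b i * (algebraMap ℂ R (b.repr (F.coeff m) i) * ∏ c ∈ m.support, v c ^ m c) := by
    intro m hm
    have h1 : F.coeff m = ∑ i ∈ F.support.biUnion (fun m => (b.repr (F.coeff m)).support),
        b.repr (F.coeff m) i • b i := by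
      conv_lhs => rw [← b.linearCombination_repr (F.coeff m)]
      rw [Finsupp.linearCombination_apply, Finsupp.sum]
      refine Finset.sum_subset (Finset.subset_biUnion_of_mem
        (fun m => (b.repr (F.coeff m)).support) hm) fun i _ hi => ?_
      simp [Finsupp.notMem_support_iff.mp hi]
    conv_lhs => rw [h1]
    rw [Finset.sum_mul]
    refine Finset.sum_congr rfl fun i _ => ?_
    rw [Algebra.smul_def]
    ring
  rw [Finset.sum_congr rfl key, Finset.sum_comm]
  refine Finset.sum_eq_zero fun i _ => ?_
  have := hz i
  simp only [Fi, map_sum, MvPolynomial.aeval_monomial, Finsupp.prod] at this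
  rw [← Finset.mul_sum, this, mul_zero]

lemma eq_sum_dualExt [FiniteDimensional ℂ 𝔤] (y : R ⊗[ℂ] 𝔤) :
    y = ∑ j, dualExt R ((Module.finBasis ℂ 𝔤).coord j) y ⊗ₜ[ℂ] (Module.finBasis ℂ 𝔤 j) := by
  induction y with
  | zero => simp
  | tmul a x =>
    conv_lhs => rw [← (Module.finBasis ℂ 𝔤).sum_repr x]
    rw [TensorProduct.tmul_sum]
    refine Finset.sum_congr rfl fun j _ => ?_
    rw [TensorProduct.tmul_smul, TensorProduct.smul_tmul', dualExt_tmul, Algebra.smul_def, mul_comm]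
    rfl
  | add y z hy hz =>
    conv_lhs => rw [hy, hz]
    simp only [map_add, TensorProduct.add_tmul, Finset.sum_add_distrib]

lemma dualExt_apply_eq_sum [FiniteDimensional ℂ 𝔤] (φ : Module.End R (R ⊗[ℂ] 𝔤))
    (l : Module.Dual ℂ 𝔤) (y : R ⊗[ℂ] 𝔤) :
    dualExt R l (φ y) = ∑ j, dualExt R ((Module.finBasis ℂ 𝔤).coord j) y *
      dualExt R l (φ (1 ⊗ₜ (Module.finBasis ℂ 𝔤 j))) := by
  conv_lhs => rw [eq_sum_dualExt y]
  simp only [map_sum]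
  refine Finset.sum_congr rfl fun j _ => ?_
  have : ∀ r : R, (r ⊗ₜ[ℂ] (Module.finBasis ℂ 𝔤 j) : R ⊗[ℂ] 𝔤) =
      r • ((1 : R) ⊗ₜ[ℂ] (Module.finBasis ℂ 𝔤 j)) := by
    intro r; simp [TensorProduct.smul_tmul']
  rw [this, map_smul, map_smul, smul_eq_mul]

/-- The `R`-points of the algebraic subgroup of `GL(𝔤)` whose group of `ℂ`-points is the
(Zariski closed) subgroup `S`: the elements of `GL(R ⊗ 𝔤)` killed by all regular functions on
`GL(𝔤)` that vanish on `S`. -/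
def points [FiniteDimensional ℂ 𝔤] (S : Subgroup (LinearMap.GeneralLinearGroup ℂ 𝔤))
    (R : Type*) [CommRing R] [Algebra ℂ R] :
    Subgroup (LinearMap.GeneralLinearGroup R (R ⊗[ℂ] 𝔤)) where
  carrier := {φ | ∀ f, VanishesOn S f → MvPolynomial.aeval (coord R φ) f = 0}
  one_mem' := by
    intro f hf
    have h := hf 1 S.one_mem
    have : coord R (1 : LinearMap.GeneralLinearGroup R (R ⊗[ℂ] 𝔤)) =
        algebraMap ℂ R ∘ coordC 1 := by
      funext c
      rcases c with ⟨x, l⟩ | ⟨x, l⟩ <;> simp [coord, coordC]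
    rw [this, MvPolynomial.aeval_algebraMap_apply, h, map_zero]
  inv_mem' := by
    intro φ hφ f hf
    have h : ∀ ψ : LinearMap.GeneralLinearGroup R (R ⊗[ℂ] 𝔤),
        coord R ψ⁻¹ = coord R ψ ∘ Sum.swap := by
      intro ψ
      funext c
      rcases c with ⟨x, l⟩ | ⟨x, l⟩ <;> simp [coord]
    have hC : ∀ σ : LinearMap.GeneralLinearGroup ℂ 𝔤,
        coordC σ⁻¹ = coordC σ ∘ Sum.swap := by
      intro ψ
      funext c
      rcases c with ⟨x, l⟩ | ⟨x, l⟩ <;> simp [coordC]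
    rw [h, ← MvPolynomial.aeval_rename]
    refine hφ _ fun σ hσ => ?_
    rw [MvPolynomial.aeval_rename, ← hC]
    exact hf _ (S.inv_mem hσ)
  mul_mem' := by
    intro φ ψ hφ hψ f hf
    let Q : Coord 𝔤 → MvPolynomial (Coord 𝔤) R
      | .inl (x, l) => ∑ j, MvPolynomial.C (coord R ψ (.inl (x, (Module.finBasis ℂ 𝔤).coord j))) *
          MvPolynomial.X (.inl (Module.finBasis ℂ 𝔤 j, l))
      | .inr (x, l) => ∑ j, MvPolynomial.X (.inr (x, (Module.finBasis ℂ 𝔤).coord j)) *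
          MvPolynomial.C (coord R ψ (.inr (Module.finBasis ℂ 𝔤 j, l)))
    have hQ : ∀ χ : LinearMap.GeneralLinearGroup R (R ⊗[ℂ] 𝔤), ∀ c,
        coord R (χ * ψ) c = MvPolynomial.eval (coord R χ) (Q c) := by
      intro χ c
      rcases c with ⟨x, l⟩ | ⟨x, l⟩
      · simp only [coord, Q, map_sum, map_mul, MvPolynomial.eval_C, MvPolynomial.eval_X,
          Units.val_mul, Module.End.mul_apply]
        exact dualExt_apply_eq_sum _ _ _
      · simp only [coord, Q, map_sum, map_mul, MvPolynomial.eval_C, MvPolynomial.eval_X,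
          Units.val_mul, Module.End.mul_apply, mul_inv_rev]
        exact dualExt_apply_eq_sum _ _ _
    have hQ' : ∀ χ : LinearMap.GeneralLinearGroup R (R ⊗[ℂ] 𝔤),
        MvPolynomial.aeval (coord R (χ * ψ)) f =
          MvPolynomial.eval (coord R χ) (MvPolynomial.aeval Q f) := by
      intro χ
      rw [show coord R (χ * ψ) = fun c => MvPolynomial.eval (coord R χ) (Q c) from funext (hQ χ)]
      have : (MvPolynomial.aeval fun c => MvPolynomial.eval (coord R χ) (Q c)) =
          (((MvPolynomial.aeval (coord R χ) : MvPolynomial (Coord 𝔤) R →ₐ[R] R).restrictScalars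
            ℂ).comp (MvPolynomial.aeval Q) : MvPolynomial (Coord 𝔤) ℂ →ₐ[ℂ] R) := by
        ext c
        simp [MvPolynomial.aeval_eq_eval]
      rw [this]
      simp [MvPolynomial.aeval_eq_eval]
    rw [hQ']
    refine eval_eq_zero_of_vanishes S _ hφ _ fun σ hσ => ?_
    let σR : LinearMap.GeneralLinearGroup R (R ⊗[ℂ] 𝔤) :=
      Units.map ((Module.End.baseChangeHom ℂ R 𝔤 : Module.End ℂ 𝔤 →* _)) σ
    have hσR : ∀ y : R ⊗[ℂ] 𝔤, σR.1 y = LinearMap.baseChange R σ.1 y := fun _ => rfl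
    have hσR' : ∀ y : R ⊗[ℂ] 𝔤, σR⁻¹.1 y = LinearMap.baseChange R σ⁻¹.1 y := fun _ => rfl
    have hc : (fun c => algebraMap ℂ R (coordC σ c)) = coord R σR := by
      funext c
      rcases c with ⟨x, l⟩ | ⟨x, l⟩
      · simp [coord, coordC, hσR]
      · simp only [coord, coordC, hσR']
        simp
    rw [hc, ← hQ']
    let r : Coord 𝔤 → Coord 𝔤
      | .inl (x, l) => .inl (x, l ∘ₗ σ.1)
      | .inr (x, l) => .inr (σ⁻¹.1 x, l)
    have hdual : ∀ (l : Module.Dual ℂ 𝔤) (y : R ⊗[ℂ] 𝔤),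
        dualExt R l (LinearMap.baseChange R σ.1 y) = dualExt R (l ∘ₗ σ.1) y := by
      intro l y
      induction y with
      | zero => simp
      | tmul a x => simp
      | add y z hy hz => simp only [map_add, hy, hz]
    have hr : coord R (σR * ψ) = coord R ψ ∘ r := by
      funext c
      rcases c with ⟨x, l⟩ | ⟨x, l⟩
      · simp only [coord, r, Function.comp, Units.val_mul, Module.End.mul_apply, hσR, hdual]
      · simp only [coord, r, Function.comp, mul_inv_rev, Units.val_mul, Module.End.mul_apply,
          hσR', LinearMap.baseChange_tmul]
    rw [hr, ← MvPolynomial.aeval_rename]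
    refine hψ _ fun τ hτ => ?_
    have hr' : coordC τ ∘ r = coordC (σ * τ) := by
      funext c
      rcases c with ⟨x, l⟩ | ⟨x, l⟩
      · simp [coordC, r]
      · simp only [coordC, r, Function.comp, mul_inv_rev, Units.val_mul, Module.End.mul_apply]
    rw [MvPolynomial.aeval_rename, hr']
    exact hf _ (S.mul_mem hσ hτ)

lemma points_mono [FiniteDimensional ℂ 𝔤] {S T : Subgroup (LinearMap.GeneralLinearGroup ℂ 𝔤)}
    (h : S ≤ T) (R : Type*) [CommRing R] [Algebra ℂ R] : points S R ≤ points T R :=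
  fun _ hφ f hf => hφ f fun σ hσ => hf σ (h hσ)

/-- Restriction of points `S(R) → S(R')` along `R → R'`. -/
def pointsExt [FiniteDimensional ℂ 𝔤] (S : Subgroup (LinearMap.GeneralLinearGroup ℂ 𝔤))
    (ρ : R →ₐ[ℂ] R') : points S R →* points S R' :=
  ((glExt 𝔤 ρ).comp (points S R).subtype).codRestrict (points S R') fun φ f hf => by
    have : coord R' (glExt 𝔤 ρ φ.1) = ρ ∘ coord R φ.1 := funext (coord_glExt ρ φ.1)
    show MvPolynomial.aeval (coord R' (glExt 𝔤 ρ φ.1)) f = 0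
    rw [this, show ρ ∘ coord R φ.1 = fun c => ρ (coord R φ.1 c) from rfl,
      ← MvPolynomial.comp_aeval_apply, φ.2 f hf, map_zero]

end Points
/-! ### The adjoint group, its Borel and Cartan subgroups, and the principal filtration -/

section Lie

variable {𝔤 : Type*} [LieRing 𝔤] [LieAlgebra ℂ 𝔤] [FiniteDimensional ℂ 𝔤]
  [LieAlgebra.IsSemisimple ℂ 𝔤]
  {H : LieSubalgebra ℂ 𝔤} [H.IsCartanSubalgebra]
  (Δ : (LieAlgebra.IsKilling.rootSystem H).Base)

/-- The simple roots `α ∈ Γ`, as linear forms on `𝔥`. -/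
def simpleRoot (i : Δ.support) : Module.Dual ℂ H :=
  (LieAlgebra.IsKilling.rootSystem H).root i

/-- The component `𝔤_k` of the principal grading: the sum of the root spaces of the
`∑ nᵢ αᵢ` with `∑ nᵢ = k`. So `𝔤_0 = 𝔥` and `𝔤_{±1}` is the sum of the `𝔤^{±α}`, `α` simple. -/
def gradedPiece (k : ℤ) : Submodule ℂ 𝔤 :=
  ⨆ (n : Δ.support → ℤ) (_ : ∑ i, n i = k),
    (LieAlgebra.rootSpace H ⇑(∑ i, n i • simpleRoot Δ i)).toSubmodule

/-- The filtration `𝔤^k = ⨁_{r ≥ k} 𝔤_r`. Here `𝔤^0 = 𝔟` is the Borel subalgebra defined by the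
base and `𝔤^1 = [𝔟, 𝔟]`. -/
def filtration (k : ℤ) : Submodule ℂ 𝔤 :=
  ⨆ (r : ℤ) (_ : k ≤ r), gradedPiece Δ r

lemma isCompl_rootSpace {𝔤 : Type*} [LieRing 𝔤] [LieAlgebra ℂ 𝔤] [FiniteDimensional ℂ 𝔤]
    (H : LieSubalgebra ℂ 𝔤) [H.IsCartanSubalgebra] (χ : H → ℂ) :
    IsCompl (LieAlgebra.rootSpace H χ).toSubmodule
      (⨆ (ψ : H → ℂ) (_ : ψ ≠ χ), (LieAlgebra.rootSpace H ψ).toSubmodule) := by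
  have hi := LieModule.iSupIndep_genWeightSpace ℂ H 𝔤
  rw [← LieSubmodule.iSupIndep_toSubmodule] at hi
  have ht := congrArg LieSubmodule.toSubmodule (LieModule.iSup_genWeightSpace_eq_top ℂ H 𝔤)
  rw [LieSubmodule.iSup_toSubmodule, LieSubmodule.top_toSubmodule] at ht
  refine ⟨hi χ, codisjoint_iff.mpr (top_le_iff.mp ?_)⟩
  rw [← ht]
  refine iSup_le fun ψ => ?_
  by_cases h : ψ = χ
  · subst h
    exact le_sup_left
  · exact le_sup_of_le_right (le_iSup₂_of_le ψ h le_rfl)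

/-- The projection `𝔤 → 𝔤^χ ⊆ 𝔤` along the other root spaces. -/
def rootProj {𝔤 : Type*} [LieRing 𝔤] [LieAlgebra ℂ 𝔤] [FiniteDimensional ℂ 𝔤]
    (H : LieSubalgebra ℂ 𝔤) [H.IsCartanSubalgebra] (χ : H → ℂ) : 𝔤 →ₗ[ℂ] 𝔤 :=
  Submodule.projection _ _ (isCompl_rootSpace H χ)

/-- `ad x` is nilpotent and `σ = exp (ad x)`. -/
def IsExpAd (x : 𝔤) (σ : LinearMap.GeneralLinearGroup ℂ 𝔤) : Prop :=
  ∃ k : ℕ, LieAlgebra.ad ℂ 𝔤 x ^ k = 0 ∧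
    σ.1 = ∑ n ∈ Finset.range k, (n.factorial : ℂ)⁻¹ • LieAlgebra.ad ℂ 𝔤 x ^ n

/-- The adjoint group `G`: the group of inner automorphisms of `𝔤`, generated by the `exp (ad x)`
with `ad x` nilpotent. -/
def adjointGroup (𝔤 : Type*) [LieRing 𝔤] [LieAlgebra ℂ 𝔤] :
    Subgroup (LinearMap.GeneralLinearGroup ℂ 𝔤) :=
  Subgroup.closure {σ | ∃ x : 𝔤, IsExpAd x σ}

/-- The Cartan subgroup of `G` with Lie algebra `𝔥`: the centralizer of `𝔥` in `G`. -/
def cartanSubgroup (H : LieSubalgebra ℂ 𝔤) : Subgroup (LinearMap.GeneralLinearGroup ℂ 𝔤) where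
  carrier := {σ | σ ∈ adjointGroup 𝔤 ∧ ∀ h ∈ H, σ.1 h = h}
  one_mem' := ⟨Subgroup.one_mem _, fun h _ => by simp⟩
  mul_mem' := fun {σ τ} hσ hτ => ⟨Subgroup.mul_mem _ hσ.1 hτ.1, fun h hh => by
    rw [Units.val_mul, Module.End.mul_apply, hτ.2 h hh, hσ.2 h hh]⟩
  inv_mem' := fun {σ} hσ => ⟨Subgroup.inv_mem _ hσ.1, fun h hh => by
    conv_lhs => rw [← hσ.2 h hh]
    rw [← Module.End.mul_apply, ← Units.val_mul, inv_mul_cancel, Units.val_one,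
      Module.End.one_apply]⟩

/-- The Borel subgroup of `G` with Lie algebra `𝔟`: it is generated by the Cartan subgroup and the
unipotent elements `exp (ad x)`, `x ∈ [𝔟, 𝔟]`. -/
def borelSubgroup : Subgroup (LinearMap.GeneralLinearGroup ℂ 𝔤) :=
  cartanSubgroup H ⊔ Subgroup.closure {σ | ∃ x ∈ filtration Δ 1, IsExpAd x σ}

lemma borelSubgroup_le : borelSubgroup Δ ≤ adjointGroup 𝔤 :=
  sup_le (fun _ h => h.1) (Subgroup.closure_mono fun _ ⟨x, _, h⟩ => ⟨x, h⟩)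

end Lie

/-! ### Spaces with a structure sheaf of `ℂ`-algebras -/

/-- The structure sheaf of a scheme over `ℂ`, as a presheaf of `ℂ`-algebras. -/
def structureSheaf {Y : Scheme.{0}} (π : Y ⟶ Spec (CommRingCat.of ℂ)) :
    TopCat.Presheaf (CommAlgCat.{0} ℂ) Y.toTopCat where
  obj U :=
    letI : Algebra ℂ Γ(Y, U.unop) :=
      ((Scheme.ΓSpecIso (CommRingCat.of ℂ)).inv ≫ π.appLE ⊤ U.unop le_top).hom.toAlgebra
    CommAlgCat.of ℂ Γ(Y, U.unop)
  map {U V} i :=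
    letI : Algebra ℂ Γ(Y, U.unop) :=
      ((Scheme.ΓSpecIso (CommRingCat.of ℂ)).inv ≫ π.appLE ⊤ U.unop le_top).hom.toAlgebra
    letI : Algebra ℂ Γ(Y, V.unop) :=
      ((Scheme.ΓSpecIso (CommRingCat.of ℂ)).inv ≫ π.appLE ⊤ V.unop le_top).hom.toAlgebra
    CommAlgCat.ofHom
      { (Y.presheaf.map i).hom with
        commutes' := fun c => by
          have := π.appLE_map (U := ⊤) (V := U.unop) (V' := V.unop) le_top i
          exact congrArg (fun f => f.hom ((Scheme.ΓSpecIso (CommRingCat.of ℂ)).inv.hom c)) this }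
  map_id U := by
    refine CommAlgCat.hom_ext ?_
    refine @AlgHom.ext _ _ _ _ _ _ (_) (_) _ _ fun x => ?_
    exact congrArg (fun f => f.hom x) (Y.presheaf.map_id U)
  map_comp i j := by
    refine CommAlgCat.hom_ext ?_
    refine @AlgHom.ext _ _ _ _ _ _ (_) (_) _ _ fun x => ?_
    exact congrArg (fun f => f.hom x) (Y.presheaf.map_comp i j)

section Geometry

universe w u

variable {X : TopCat.{0}} (O : TopCat.Presheaf (CommAlgCat.{0} ℂ) X)

/-- Restriction of functions. -/
def resO {U V : Opens X} (h : V ≤ U) : O.obj (op U) →ₐ[ℂ] O.obj (op V) :=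
  (O.map (homOfLE h).op).hom

/-- Sections over `U` of the sheaf `Θ` of vector fields, i.e. of `ℂ`-linear derivations of the
structure sheaf. -/
@[ext]
structure VectorField (U : Opens X) where
  der : ∀ V : Opens X, V ≤ U → Derivation ℂ (O.obj (op V)) (O.obj (op V))
  der_res : ∀ (V W : Opens X) (hV : V ≤ U) (hW : W ≤ V) (f : O.obj (op V)),
    der W (hW.trans hV) (resO O hW f) = resO O hW (der V hV f)

namespace VectorField

variable {O} {U : Opens X}

instance : Add (VectorField O U) where
  add θ η :=
    { der := fun V hV => θ.der V hV + η.der V hV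
      der_res := fun V W hV hW f => by simp [θ.der_res V W hV hW, η.der_res V W hV hW] }

lemma resO_resO {U V W : Opens X} (hV : V ≤ U) (hW : W ≤ V) (f : O.obj (op U)) :
    resO O hW (resO O hV f) = resO O (hW.trans hV) f := by
  have := O.map_comp (homOfLE hV).op (homOfLE hW).op
  exact (congrArg (fun g => g.hom f) this).symm

instance : SMul (O.obj (op U)) (VectorField O U) where
  smul f θ :=
    { der := fun V hV => resO O hV f • θ.der V hV
      der_res := fun V W hV hW g => by
        simp [θ.der_res V W hV hW, resO_resO] }

/-- Restriction of vector fields. -/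
def restrict (θ : VectorField O U) {V : Opens X} (hV : V ≤ U) : VectorField O V where
  der W hW := θ.der W (hW.trans hV)
  der_res W W' hW hW' f := θ.der_res W W' (hW.trans hV) hW' f

end VectorField

variable {𝔤 : Type u} [LieRing 𝔤] [LieAlgebra ℂ 𝔤] [FiniteDimensional ℂ 𝔤]

/-- A presheaf of sets on `X` with a right action of the sheaf of groups `U ↦ S(O(U))`. -/
structure GSpace (S : Subgroup (LinearMap.GeneralLinearGroup ℂ 𝔤)) where
  sec : Opens X → Type w
  res : ∀ {U V : Opens X}, V ≤ U → sec U → sec V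
  res_self : ∀ {U : Opens X} (s : sec U), res le_rfl s = s
  res_res : ∀ {U V W : Opens X} (hV : V ≤ U) (hW : W ≤ V) (s : sec U),
    res hW (res hV s) = res (hW.trans hV) s
  act : ∀ {U : Opens X}, sec U → points S (O.obj (op U)) → sec U
  act_one : ∀ {U : Opens X} (s : sec U), act s 1 = s
  act_mul : ∀ {U : Opens X} (s : sec U) (b c : points S (O.obj (op U))),
    act s (b * c) = act (act s b) c
  res_act : ∀ {U V : Opens X} (h : V ≤ U) (s : sec U) (b : points S (O.obj (op U))),
    res h (act s b) = act (res h s) (pointsExt S (resO O h) b)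

/-- The underlying presheaf of sets. -/
def GSpace.presheaf {O : TopCat.Presheaf (CommAlgCat.{0} ℂ) X}
    {S : Subgroup (LinearMap.GeneralLinearGroup ℂ 𝔤)} (P : GSpace.{w} O S) :
    TopCat.Presheaf (Type w) X where
  obj U := P.sec U.unop
  map i := TypeCat.ofHom (P.res i.unop.le)
  map_id U := by
    ext s
    exact P.res_self s
  map_comp i j := by
    ext s
    exact (P.res_res i.unop.le j.unop.le s).symm

/-- A principal bundle for the algebraic group `S`, given by its sheaf of sections: a sheaf of sets
with a simply transitive right action of `U ↦ S(O(U))` that locally has sections. -/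
structure PrincipalBundle (S : Subgroup (LinearMap.GeneralLinearGroup ℂ 𝔤)) extends
    GSpace.{w} O S where
  isSheaf : toGSpace.presheaf.IsSheaf
  simply_transitive : ∀ {U : Opens X} (s t : sec U),
    ∃! b : points S (O.obj (op U)), act s b = t
  locally_nonempty : ∀ x : X, ∃ U : Opens X, x ∈ U ∧ Nonempty (sec U)

variable {O}

namespace GSpace

variable {S T : Subgroup (LinearMap.GeneralLinearGroup ℂ 𝔤)} (F : GSpace.{w} O S)

/-- Sections over `U` of `F ×^S T`. A section `p` is recorded by the functions `val` with
`p = s · val(s)`, for `s` a local section of `F`; thus `val(s · b) = b⁻¹ val(s)`. -/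
@[ext]
structure InducedSec (hST : S ≤ T) (U : Opens X) : Type (max u w) where
  val : ∀ V : Opens X, V ≤ U → F.sec V → points T (O.obj (op V))
  val_res : ∀ (V W : Opens X) (hV : V ≤ U) (hW : W ≤ V) (s : F.sec V),
    val W (hW.trans hV) (F.res hW s) = pointsExt T (resO O hW) (val V hV s)
  val_act : ∀ (V : Opens X) (hV : V ≤ U) (s : F.sec V) (b : points S (O.obj (op V))),
    val V hV (F.act s b) = (Subgroup.inclusion (points_mono hST _) b)⁻¹ * val V hV s

lemma pointsExt_resO (T : Subgroup (LinearMap.GeneralLinearGroup ℂ 𝔤)) {U V W : Opens X}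
    (hV : V ≤ U) (hW : W ≤ V) (k : points T (O.obj (op U))) :
    pointsExt T (resO O hW) (pointsExt T (resO O hV) k) =
      pointsExt T (resO O (hW.trans hV)) k := by
  refine Subtype.ext (Units.ext ?_)
  refine TensorProduct.AlgebraTensorModule.curry_injective ?_
  ext x
  show endExt (resO O hW) (endExt (resO O hV) k.1.1) (1 ⊗ₜ x) =
    endExt (resO O (hW.trans hV)) k.1.1 (1 ⊗ₜ x)
  simp only [endExt_tmul, one_smul]
  generalize k.1.1 (1 ⊗ₜ x) = y
  induction y with
  | zero => simp
  | tmul a z => simp [VectorField.resO_resO]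
  | add y z hy hz => simp [hy, hz]

/-- The `T`-bundle `F ×^S T` induced by an `S`-bundle `F`, for `S ≤ T`; the right action of `T` is
`(s · val(s)) · k = s · (val(s) k)`. -/
def induced (hST : S ≤ T) : GSpace.{max u w} O T where
  sec := F.InducedSec hST
  res h p :=
    { val := fun V hV => p.val V (hV.trans h)
      val_res := fun V W hV hW s => p.val_res V W (hV.trans h) hW s
      val_act := fun V hV s b => p.val_act V (hV.trans h) s b }
  res_self _ := rfl
  res_res _ _ _ := rfl
  act p k :=
    { val := fun V hV s => p.val V hV s * pointsExt T (resO O hV) k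
      val_res := fun V W hV hW s => by
        rw [p.val_res V W hV hW s, map_mul, pointsExt_resO]
      val_act := fun V hV s b => by rw [p.val_act V hV s b, mul_assoc] }
  act_one p := by
    ext V hV s : 4
    simp
  act_mul p k m := by
    ext V hV s : 4
    simp [mul_assoc]
  res_act h p k := by
    ext V hV s : 4
    simp [pointsExt_resO]

end GSpace

namespace PrincipalBundle

variable {S T : Subgroup (LinearMap.GeneralLinearGroup ℂ 𝔤)} (F : PrincipalBundle.{w} O S)

/-- The `b` with `s · b = t`. -/
def div {U : Opens X} (s t : F.sec U) : points S (O.obj (op U)) :=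
  (F.simply_transitive s t).choose

lemma act_div {U : Opens X} (s t : F.sec U) : F.act s (F.div s t) = t :=
  (F.simply_transitive s t).choose_spec.1

lemma eq_div {U : Opens X} {s t : F.sec U} {b : points S (O.obj (op U))}
    (h : F.act s b = t) : b = F.div s t :=
  (F.simply_transitive s t).choose_spec.2 b h

/-- The canonical map `F → F ×^S T`. -/
def toInduced (hST : S ≤ T) {U : Opens X} (t : F.sec U) : (F.induced hST).sec U where
  val V hV s := Subgroup.inclusion (points_mono hST _) (F.div s (F.res hV t))
  val_res V W hV hW s := by
    have : F.div (F.res hW s) (F.res (hW.trans hV) t) =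
        pointsExt S (resO O hW) (F.div s (F.res hV t)) := by
      refine (F.eq_div ?_).symm
      rw [← F.res_act, F.act_div, F.res_res]
    rw [this]
    rfl
  val_act V hV s b := by
    have : F.div (F.act s b) (F.res hV t) = b⁻¹ * F.div s (F.res hV t) := by
      refine (F.eq_div ?_).symm
      rw [← F.act_mul, mul_inv_cancel_left, F.act_div]
    rw [this, map_mul, map_inv]

/-- Isomorphisms of principal bundles. -/
@[ext]
structure Iso (F F' : PrincipalBundle.{w} O S) where
  toEquiv : ∀ U : Opens X, F.sec U ≃ F'.sec U
  map_res : ∀ {U V : Opens X} (h : V ≤ U) (s : F.sec U),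
    toEquiv V (F.res h s) = F'.res h (toEquiv U s)
  map_act : ∀ {U : Opens X} (s : F.sec U) (b : points S (O.obj (op U))),
    toEquiv U (F.act s b) = F'.act (toEquiv U s) b

/-- The identity isomorphism. -/
def Iso.refl : Iso F F where
  toEquiv _ := Equiv.refl _
  map_res _ _ := rfl
  map_act _ _ := rfl

variable {F} {F' : PrincipalBundle.{w} O S}

/-- The isomorphism `F ×^S T → F' ×^S T` induced by an isomorphism `f : F → F'`; it sends
`s · k` to `f(s) · k`. -/
def Iso.mapInduced (f : Iso F F') (hST : S ≤ T) {U : Opens X}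
    (p : (F.induced hST).sec U) : (F'.induced hST).sec U where
  val V hV s := GSpace.InducedSec.val p V hV ((f.toEquiv V).symm s)
  val_res V W hV hW s := by
    rw [← GSpace.InducedSec.val_res p V W hV hW]
    congr 1
    rw [Equiv.symm_apply_eq, f.map_res, Equiv.apply_symm_apply]
  val_act V hV s b := by
    rw [← GSpace.InducedSec.val_act p V hV]
    congr 1
    rw [Equiv.symm_apply_eq, f.map_act, Equiv.apply_symm_apply]

end PrincipalBundle

/-- The action of a derivation of `R` on `R ⊗ 𝔤`. -/
def derExt (𝔤 : Type*) [AddCommGroup 𝔤] [Module ℂ 𝔤] {R : Type*} [CommRing R] [Algebra ℂ R]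
    (D : Derivation ℂ R R) : R ⊗[ℂ] 𝔤 →ₗ[ℂ] R ⊗[ℂ] 𝔤 :=
  LinearMap.rTensor 𝔤 (D : R →ₗ[ℂ] R)

/-- Sections over `U` of the algebroid `ℰ_P` of infinitesimal symmetries of a bundle `P` for the
adjoint group. In the trivialization of `P` given by a local section `p` an infinitesimal symmetry
is `θ + A(p)`, with `θ` a vector field and `A(p)` a function with values in `𝔤`; if `p` is replaced
by `p · k` it becomes `k⁻¹ (θ + A(p)) k`, as operators in the adjoint representation. -/
@[ext]
structure InfSymm (P : GSpace.{w} O (adjointGroup 𝔤)) (U : Opens X) where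
  anchor : VectorField O U
  form : ∀ V : Opens X, V ≤ U → P.sec V → O.obj (op V) ⊗[ℂ] 𝔤
  form_res : ∀ (V W : Opens X) (hV : V ≤ U) (hW : W ≤ V) (p : P.sec V),
    form W (hW.trans hV) (P.res hW p) = extMap 𝔤 (resO O hW) (form V hV p)
  gauge : ∀ (V : Opens X) (hV : V ≤ U) (p : P.sec V)
    (k : points (adjointGroup 𝔤) (O.obj (op V))) (y : O.obj (op V) ⊗[ℂ] 𝔤),
    derExt 𝔤 (anchor.der V hV) y + ⁅form V hV (P.act p k), y⁆ =
      k⁻¹.1.1 (derExt 𝔤 (anchor.der V hV) (k.1.1 y) + ⁅form V hV p, k.1.1 y⁆)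

/-- A connection on `P`: an `O`-linear splitting `∇ : Θ → ℰ_P` of the anchor `ℰ_P → Θ`. -/
structure Connection (P : GSpace.{w} O (adjointGroup 𝔤)) where
  nabla : ∀ {U : Opens X}, VectorField O U → InfSymm P U
  anchor_nabla : ∀ {U : Opens X} (θ : VectorField O U), (nabla θ).anchor = θ
  nabla_add : ∀ {U : Opens X} (θ η : VectorField O U) (V : Opens X) (hV : V ≤ U)
    (p : P.sec V),
    (nabla (θ + η)).form V hV p = (nabla θ).form V hV p + (nabla η).form V hV p
  nabla_smul : ∀ {U : Opens X} (f : O.obj (op U)) (θ : VectorField O U) (V : Opens X) (hV : V ≤ U)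
    (p : P.sec V),
    (nabla (f • θ)).form V hV p = resO O hV f • (nabla θ).form V hV p
  nabla_restrict : ∀ {U V : Opens X} (hV : V ≤ U) (θ : VectorField O U) (W : Opens X) (hW : W ≤ V)
    (p : P.sec W),
    (nabla (θ.restrict hV)).form W hW p = (nabla θ).form W (hW.trans hV) p

/-! ### Opers -/

variable [LieAlgebra.IsSemisimple ℂ 𝔤] {H : LieSubalgebra ℂ 𝔤} [H.IsCartanSubalgebra]
  {Δ : (LieAlgebra.IsKilling.rootSystem H).Base}

/-- The `G`-bundle corresponding to a `B`-bundle. -/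
abbrev gBundle (F : PrincipalBundle.{w} O (borelSubgroup Δ)) :
    GSpace.{max u w} O (adjointGroup 𝔤) :=
  F.induced (borelSubgroup_le Δ)

/-- The step `ℰ^k_F`, `k ≤ 0`, of the filtration of the algebroid `ℰ^𝔤_F` of infinitesimal
symmetries of the `G`-bundle: in the trivialization given by any local section of `F` the
`𝔤`-component lies in `𝔤^k`. For `k = 0` these are the infinitesimal symmetries of `F`. -/
def MemFiltration (F : PrincipalBundle.{w} O (borelSubgroup Δ)) (k : ℤ) {U : Opens X}
    (e : InfSymm (gBundle F) U) : Prop :=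
  ∀ (V : Opens X) (hV : V ≤ U) (s : F.sec V),
    e.form V hV (F.toInduced (borelSubgroup_le Δ) s) ∈
      (filtration Δ k).baseChange (O.obj (op V))

/-- Sections over `U` of the twist `𝔤^{-α}_F`, `α` a simple root: functions `v` from the local
sections of `F` to `𝔤^{-α}` with `v(s · b) = b⁻¹ v(s)`. Here `B` acts on `𝔤^{-α}` as on the direct
summand `𝔤^{-α}` of `𝔤^{-1} / 𝔟`, which is the action through `B → H`. -/
def rootTwist (F : PrincipalBundle.{w} O (borelSubgroup Δ)) (i : Δ.support) (U : Opens X) :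
    Set (∀ V : Opens X, V ≤ U → F.sec V → O.obj (op V) ⊗[ℂ] 𝔤) :=
  {v | (∀ (V : Opens X) (hV : V ≤ U) (s : F.sec V),
      v V hV s ∈ (LieAlgebra.rootSpace H ⇑(-simpleRoot Δ i)).toSubmodule.baseChange
        (O.obj (op V))) ∧
    (∀ (V W : Opens X) (hV : V ≤ U) (hW : W ≤ V) (s : F.sec V),
      v W (hW.trans hV) (F.res hW s) = extMap 𝔤 (resO O hW) (v V hV s)) ∧
    (∀ (V : Opens X) (hV : V ≤ U) (s : F.sec V)
      (b : points (borelSubgroup Δ) (O.obj (op V))),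
      v V hV (F.act s b) =
        (rootProj H ⇑(-simpleRoot Δ i)).baseChange (O.obj (op V)) (b⁻¹.1.1 (v V hV s)))}

/-- The map `ℰ^{-1}_F → ℰ^{-1}_F / ℰ_F → 𝔤^{-α}_F`. -/
def rootComponent (F : PrincipalBundle.{w} O (borelSubgroup Δ)) (i : Δ.support) {U : Opens X}
    (e : InfSymm (gBundle F) U) :
    ∀ V : Opens X, V ≤ U → F.sec V → O.obj (op V) ⊗[ℂ] 𝔤 :=
  fun V hV s => (rootProj H ⇑(-simpleRoot Δ i)).baseChange (O.obj (op V))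
    (e.form V hV (F.toInduced (borelSubgroup_le Δ) s))

variable (O Δ) in
/-- A `𝔤`-oper: a `B`-bundle `F` with a connection `∇` on the corresponding `G`-bundle such that
`∇(Θ) ⊆ ℰ^{-1}_F` and, for every simple root `α`, the composition
`Θ → ℰ^{-1}_F → ℰ^{-1}_F / ℰ_F → 𝔤^{-α}_F` is an isomorphism of sheaves, where `G` is the adjoint
group of `𝔤`. -/
structure Oper where
  bundle : PrincipalBundle.{w} O (borelSubgroup Δ)
  conn : Connection (gBundle bundle)
  nabla_mem : ∀ {U : Opens X} (θ : VectorField O U), MemFiltration bundle (-1) (conn.nabla θ)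
  bijective : ∀ (i : Δ.support) (U : Opens X),
    Set.BijOn (fun θ : VectorField O U => rootComponent bundle i (conn.nabla θ)) Set.univ
      (rootTwist bundle i U)

namespace Oper

/-- Isomorphisms of opers: isomorphisms of `B`-bundles that are compatible with the
connections. -/
@[ext]
structure Iso (E E' : Oper.{w} O Δ) extends PrincipalBundle.Iso E.bundle E'.bundle where
  map_conn : ∀ {U : Opens X} (θ : VectorField O U) (V : Opens X) (hV : V ≤ U)
    (p : (gBundle E.bundle).sec V),
    (E'.conn.nabla θ).form V hV (toIso.mapInduced (borelSubgroup_le Δ) p) =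
      (E.conn.nabla θ).form V hV p

/-- The trivial automorphism of an oper. -/
def Iso.refl (E : Oper.{w} O Δ) : Iso E E where
  toIso := PrincipalBundle.Iso.refl E.bundle
  map_conn _ _ _ _ := rfl

end Oper

end Geometry

end

end Opers

namespace Opers

noncomputable section

/-!
An automorphism `φ` of an oper is given, in the trivialization defined by a local section `s`, by
the `B`-valued function `b` with `φ(s) = s b`. If `∇_θ = θ + A` in this trivialization, then `b`
is a gauge transformation fixing `∇_θ`, and by the oper condition `θ` can be chosen so that `A` is
`f = ∑ uᵢ fᵢ` up to terms of degree `≥ 0`, with invertible coefficients `uᵢ`. Over the ring of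
functions there is an `𝔰𝔩₂`-triple `(e, 2ρ, f)`, where `ρ ∈ 𝔥` induces the grading, so `ad f` is
injective in positive degrees and `ad e` in negative ones. Since `b` is trivial on `𝔥` modulo `𝔤^1`
and `bf - f` has degree `≥ 0`, it follows degree by degree that `b` acts trivially on the
associated graded algebra. If moreover `bρ - ρ` lies in `𝔤^m` with `m ≥ 1`, then `b` differs from
the identity by an operator raising degrees by `m`; gauge invariance puts `bA - A` in `𝔤^m`, hence
also `bf - f`, and the injectivity of `ad f` in degree `m` puts `bρ - ρ` in `𝔤^(m+1)`. Therefore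
`bρ = ρ`, so `b` preserves the grading, and `b = 1`.
-/

/-! ### The principal grading -/

section RootProjection

open LieAlgebra

variable {𝔤 : Type*} [LieRing 𝔤] [LieAlgebra ℂ 𝔤] [FiniteDimensional ℂ 𝔤]
  {H : LieSubalgebra ℂ 𝔤} [H.IsCartanSubalgebra]

lemma rootSpace_zero_toSubmodule : (rootSpace H (0 : H → ℂ)).toSubmodule = H.toSubmodule := by
  rw [rootSpace_zero_eq]
  rfl

lemma rootProj_apply_of_mem {χ : H → ℂ} {x : 𝔤} (hx : x ∈ rootSpace H χ) :
    rootProj H χ x = x :=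
  Submodule.projection_apply_of_mem_left _ hx

lemma rootProj_apply_of_ne {χ ψ : H → ℂ} (h : ψ ≠ χ) {x : 𝔤} (hx : x ∈ rootSpace H ψ) :
    rootProj H χ x = 0 :=
  (Submodule.projection_apply_eq_zero_iff _).mpr
    ((le_iSup₂_of_le (f := fun (ψ : H → ℂ) (_ : ψ ≠ χ) => (rootSpace H ψ).toSubmodule)
      ψ h le_rfl) hx)

lemma rootProj_mem (χ : H → ℂ) (x : 𝔤) : rootProj H χ x ∈ rootSpace H χ :=
  Submodule.projection_apply_mem _ x

end RootProjection

section PrincipalGrading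

open LieAlgebra LieModule

variable {𝔤 : Type*} [LieRing 𝔤] [LieAlgebra ℂ 𝔤] [FiniteDimensional ℂ 𝔤]
  [LieAlgebra.IsSemisimple ℂ 𝔤]
  {H : LieSubalgebra ℂ 𝔤} [H.IsCartanSubalgebra]
  (Δ : (LieAlgebra.IsKilling.rootSystem H).Base)

/-- The element `∑ nᵢ αᵢ` of the root lattice. -/
def latticeWeight : (Δ.support → ℤ) →ₗ[ℤ] Module.Dual ℂ H :=
  Fintype.linearCombination ℤ (simpleRoot Δ)

lemma simpleRoot_eq_toWeightBasis : simpleRoot Δ = Δ.toWeightBasis := by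
  ext1 i
  simp [simpleRoot]

lemma latticeWeight_single [DecidableEq Δ.support] (i : Δ.support) :
    latticeWeight Δ (Pi.single i 1) = simpleRoot Δ i := by
  simp [latticeWeight, Fintype.linearCombination_apply_single]

lemma latticeWeight_injective : Function.Injective (latticeWeight Δ) := by
  have hli : LinearIndependent ℂ (simpleRoot Δ) :=
    simpleRoot_eq_toWeightBasis Δ ▸ Δ.toWeightBasis.linearIndependent
  exact linearIndependent_iff_injective_fintypeLinearCombination.mp
    (hli.restrict_scalars (by simpa using Int.cast_injective))

lemma rootSpace_latticeWeight_le (n : Δ.support → ℤ) :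
    (rootSpace H ⇑(latticeWeight Δ n)).toSubmodule ≤ gradedPiece Δ (∑ i, n i) :=
  le_iSup₂_of_le (f := fun (m : Δ.support → ℤ) (_ : ∑ i, m i = ∑ i, n i) =>
    (rootSpace H ⇑(latticeWeight Δ m)).toSubmodule) n rfl le_rfl

lemma gradedPiece_le {k : ℤ} {P : Submodule ℂ 𝔤}
    (h : ∀ n : Δ.support → ℤ, ∑ i, n i = k → ∀ x ∈ rootSpace H ⇑(latticeWeight Δ n), x ∈ P) :
    gradedPiece Δ k ≤ P :=
  iSup₂_le h

lemma gradedPiece_le_filtration {k r : ℤ} (h : k ≤ r) : gradedPiece Δ r ≤ filtration Δ k :=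
  le_iSup₂_of_le (f := fun (r : ℤ) (_ : k ≤ r) => gradedPiece Δ r) r h le_rfl

lemma filtration_antitone : Antitone (filtration Δ) := fun _ _ h =>
  iSup₂_le fun _ hr => gradedPiece_le_filtration Δ (h.trans hr)

lemma filtration_eq_sup (k : ℤ) :
    filtration Δ k = gradedPiece Δ k ⊔ filtration Δ (k + 1) := by
  refine le_antisymm (iSup₂_le fun r hr => ?_)
    (sup_le (gradedPiece_le_filtration Δ le_rfl) (filtration_antitone Δ (by omega)))
  rcases hr.eq_or_lt with rfl | hr
  · exact le_sup_left
  · exact le_sup_of_le_right (gradedPiece_le_filtration Δ (by omega))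

lemma lie_mem_gradedPiece {j k : ℤ} {x y : 𝔤} (hx : x ∈ gradedPiece Δ j)
    (hy : y ∈ gradedPiece Δ k) : ⁅x, y⁆ ∈ gradedPiece Δ (j + k) := by
  suffices h : Submodule.map₂ (toEnd ℂ 𝔤 𝔤 : 𝔤 →ₗ[ℂ] Module.End ℂ 𝔤)
      (gradedPiece Δ j) (gradedPiece Δ k) ≤ gradedPiece Δ (j + k) from
    Submodule.map₂_le.mp h x hx y hy
  simp only [gradedPiece, Submodule.map₂_iSup_left, Submodule.map₂_iSup_right, iSup_le_iff]
  rintro m rfl n rfl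
  refine Submodule.map₂_le.mpr fun a ha b hb => ?_
  have hab : ⁅a, b⁆ ∈ rootSpace H ⇑(latticeWeight Δ (n + m)) := by
    rw [map_add]
    exact lie_mem_genWeightSpace_of_mem_genWeightSpace ha hb
  rw [← Finset.sum_add_distrib]
  exact rootSpace_latticeWeight_le Δ (n + m) hab

lemma lie_mem_filtration {j k : ℤ} {x y : 𝔤} (hx : x ∈ filtration Δ j)
    (hy : y ∈ filtration Δ k) : ⁅x, y⁆ ∈ filtration Δ (j + k) := by
  suffices h : Submodule.map₂ (toEnd ℂ 𝔤 𝔤 : 𝔤 →ₗ[ℂ] Module.End ℂ 𝔤)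
      (filtration Δ j) (filtration Δ k) ≤ filtration Δ (j + k) from
    Submodule.map₂_le.mp h x hx y hy
  rw [filtration, filtration]
  simp only [Submodule.map₂_iSup_left, Submodule.map₂_iSup_right, iSup_le_iff]
  intro s hs r hr
  exact Submodule.map₂_le.mpr fun a ha b hb =>
    gradedPiece_le_filtration Δ (by omega) (lie_mem_gradedPiece Δ ha hb)

lemma nonneg_or_nonpos_of_rootSpace_ne_bot {n : Δ.support → ℤ}
    (h : rootSpace H ⇑(latticeWeight Δ n) ≠ ⊥) : 0 ≤ n ∨ n ≤ 0 := by
  classical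
  by_cases hn : n = 0
  · exact .inl hn.ge
  let χ : Weight ℂ H 𝔤 := ⟨⇑(latticeWeight Δ n), h⟩
  have hχ : χ.IsNonZero := fun h0 =>
    hn (latticeWeight_injective Δ (by rw [map_zero]; exact DFunLike.coe_injective h0))
  let f : H.root → ℤ := fun i => if hi : i ∈ Δ.support then n ⟨i, hi⟩ else 0
  have hsum : ∑ j ∈ Δ.support, f j • (IsKilling.rootSystem H).root j = latticeWeight Δ n := by
    rw [latticeWeight, Fintype.linearCombination_apply, ← Finset.sum_coe_sort]
    exact Finset.sum_congr rfl fun i _ => by simp [f, simpleRoot]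
  have hroot : ∑ j ∈ Δ.support, f j • (IsKilling.rootSystem H).root j ∈
      Set.range (IsKilling.rootSystem H).root := by
    rw [hsum]
    exact ⟨⟨χ, by simpa using hχ⟩, rfl⟩
  have hsupp : f.support ⊆ Δ.support := fun i hi => by
    by_contra hcon
    exact hi (dif_neg hcon)
  refine (Δ.pos_or_neg_of_sum_smul_root_mem f hroot hsupp).imp (fun h i => ?_) (fun h i => ?_)
  all_goals simpa [f] using h.le i.1

lemma gradedPiece_zero : gradedPiece Δ 0 = H.toSubmodule := by
  rw [← rootSpace_zero_toSubmodule]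
  refine le_antisymm (gradedPiece_le Δ fun n hn x hx => ?_) ?_
  · by_cases hb : rootSpace H ⇑(latticeWeight Δ n) = ⊥
    · rw [hb, LieSubmodule.mem_bot] at hx
      exact hx ▸ zero_mem _
    have hn0 : n = 0 := by
      funext i
      rcases nonneg_or_nonpos_of_rootSpace_ne_bot Δ hb with h | h
      · exact (Finset.sum_eq_zero_iff_of_nonneg fun i _ => h i).mp hn i (Finset.mem_univ i)
      · exact (Finset.sum_eq_zero_iff_of_nonpos fun i _ => h i).mp hn i (Finset.mem_univ i)
    rw [hn0, map_zero] at hx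
    exact hx
  · have h := rootSpace_latticeWeight_le Δ 0
    rw [map_zero] at h
    simp only [Pi.zero_apply, Finset.sum_const_zero] at h
    exact h

lemma rootSpace_simpleRoot_le (i : Δ.support) :
    (rootSpace H ⇑(simpleRoot Δ i)).toSubmodule ≤ gradedPiece Δ 1 := by
  classical
  simpa [latticeWeight_single] using rootSpace_latticeWeight_le Δ (Pi.single i 1)

lemma rootSpace_neg_simpleRoot_le (i : Δ.support) :
    (rootSpace H ⇑(-simpleRoot Δ i)).toSubmodule ≤ gradedPiece Δ (-1) := by
  classical
  have h := rootSpace_latticeWeight_le Δ (-Pi.single i 1)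
  rw [map_neg, latticeWeight_single] at h
  simpa using h

lemma filtration_zero_le_ker_rootProj (i : Δ.support) :
    filtration Δ 0 ≤ LinearMap.ker (rootProj H ⇑(-simpleRoot Δ i)) := by
  classical
  refine iSup₂_le fun r hr => gradedPiece_le Δ fun n hn x hx =>
    rootProj_apply_of_ne (fun h => ?_) hx
  rw [DFunLike.coe_fn_eq, ← latticeWeight_single, ← map_neg] at h
  rw [latticeWeight_injective Δ h] at hn
  simp only [Pi.neg_apply, Finset.sum_neg_distrib, Fintype.sum_pi_single'] at hn
  omega

lemma exists_eq_neg_single_of_nonpos {ι : Type*} [Fintype ι] [DecidableEq ι] {n : ι → ℤ}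
    (hn : n ≤ 0) (hsum : ∑ i, n i = -1) : ∃ i, n = -Pi.single i 1 := by
  obtain ⟨i, -, hi⟩ : ∃ i ∈ Finset.univ, n i < 0 := by
    by_contra! h
    have := Finset.sum_nonneg h
    omega
  have hrest : n + Pi.single i 1 ≤ 0 := fun j => by
    by_cases hj : j = i
    · subst hj
      simpa using hi
    · simpa [hj] using hn j
  have hsum_rest : ∑ j, (n + Pi.single i 1 : ι → ℤ) j = 0 := by
    simp [Finset.sum_add_distrib, hsum]
  refine ⟨i, eq_neg_of_add_eq_zero_left (funext fun j => ?_)⟩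
  exact (Finset.sum_eq_zero_iff_of_nonpos fun j _ => hrest j).mp hsum_rest j (Finset.mem_univ j)

lemma sum_rootProj_of_mem_gradedPiece {x : 𝔤} (hx : x ∈ gradedPiece Δ (-1)) :
    ∑ i, rootProj H ⇑(-simpleRoot Δ i) x = x := by
  classical
  suffices h : gradedPiece Δ (-1) ≤
      LinearMap.eqLocus (∑ i, rootProj H ⇑(-simpleRoot Δ i)) LinearMap.id by
    simpa using h hx
  refine gradedPiece_le Δ fun n hn x hx => ?_
  by_cases hb : rootSpace H ⇑(latticeWeight Δ n) = ⊥
  · rw [hb, LieSubmodule.mem_bot] at hx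
    exact hx ▸ zero_mem _
  have hneg : n ≤ 0 := (nonneg_or_nonpos_of_rootSpace_ne_bot Δ hb).resolve_left fun h => by
    have := Finset.sum_nonneg fun i (_ : i ∈ Finset.univ) => h i
    omega
  obtain ⟨i, rfl⟩ := exists_eq_neg_single_of_nonpos hneg hn
  rw [map_neg, latticeWeight_single] at hx
  rw [LinearMap.mem_eqLocus, LinearMap.sum_apply, Finset.sum_eq_single i, rootProj_apply_of_mem hx,
    LinearMap.id_apply]
  · intro j _ hj
    refine rootProj_apply_of_ne (fun h => hj ?_) hx
    rw [DFunLike.coe_fn_eq, neg_inj, simpleRoot_eq_toWeightBasis] at h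
    exact (Δ.toWeightBasis.injective h).symm
  · simp

lemma sub_sum_rootProj_mem_filtration {x : 𝔤} (hx : x ∈ filtration Δ (-1)) :
    x - ∑ i, rootProj H ⇑(-simpleRoot Δ i) x ∈ filtration Δ 0 := by
  rw [filtration_eq_sup, Submodule.mem_sup] at hx
  obtain ⟨y, hy, z, hz, rfl⟩ := hx
  have hz' : ∑ i, rootProj H ⇑(-simpleRoot Δ i) z = 0 :=
    Finset.sum_eq_zero fun i _ => filtration_zero_le_ker_rootProj Δ i hz
  simp only [map_add, Finset.sum_add_distrib, sum_rootProj_of_mem_gradedPiece Δ hy, hz']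
  simpa using hz

/-- The element `ρ^∨` of `𝔥` on which every simple root takes the value `1`. -/
def gradingElement : H :=
  (Module.evalEquiv ℂ H).symm (Δ.toWeightBasis.constr ℂ fun _ => (1 : ℂ))

lemma simpleRoot_gradingElement (i : Δ.support) : simpleRoot Δ i (gradingElement Δ) = 1 := by
  rw [gradingElement, Module.apply_evalEquiv_symm_apply, simpleRoot_eq_toWeightBasis,
    Module.Basis.constr_basis]

lemma lie_gradingElement {k : ℤ} {x : 𝔤} (hx : x ∈ gradedPiece Δ k) :
    ⁅(gradingElement Δ : 𝔤), x⁆ = (k : ℂ) • x := by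
  suffices h : gradedPiece Δ k ≤ (ad ℂ 𝔤 (gradingElement Δ : 𝔤)).eigenspace k from
    Module.End.mem_eigenspace_iff.mp (h hx)
  refine gradedPiece_le Δ fun n hn x hx => Module.End.mem_eigenspace_iff.mpr ?_
  have hval : latticeWeight Δ n (gradingElement Δ) = k := by
    simp [latticeWeight, Fintype.linearCombination_apply, simpleRoot_gradingElement, ← hn]
  rw [← hval]
  exact IsKilling.lie_eq_smul_of_mem_rootSpace hx (gradingElement Δ)

lemma exists_gradedPiece_eq_bot : ∃ N : ℕ, ∀ k : ℤ, N < |k| → gradedPiece Δ k = ⊥ := by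
  have hfin := Module.End.finite_hasEigenvalue (ad ℂ 𝔤 (gradingElement Δ : 𝔤))
  have hfin2 : {k : ℤ | gradedPiece Δ k ≠ ⊥}.Finite := by
    refine (hfin.preimage (f := fun k : ℤ => (k : ℂ)) Int.cast_injective.injOn).subset ?_
    intro k hk
    obtain ⟨x, hx, hx0⟩ := Submodule.exists_mem_ne_zero_of_ne_bot hk
    exact Module.End.hasEigenvalue_of_hasEigenvector
      ⟨Module.End.mem_eigenspace_iff.mpr (lie_gradingElement Δ hx), hx0⟩
  obtain ⟨N, hN⟩ := (hfin2.image Int.natAbs).bddAbove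
  refine ⟨N, fun k hk => ?_⟩
  by_contra hcon
  have : k.natAbs ≤ N := hN ⟨k, hcon, rfl⟩
  rw [Int.abs_eq_natAbs] at hk
  omega

lemma exists_filtration_eq_bot : ∃ N : ℕ, filtration Δ N = ⊥ := by
  obtain ⟨N, hN⟩ := exists_gradedPiece_eq_bot Δ
  refine ⟨N + 1, eq_bot_iff.mpr (iSup₂_le fun r hr => (hN r ?_).le)⟩
  have := le_abs_self r
  push_cast at hr
  linarith

lemma exists_latticeWeight_eq (χ : Weight ℂ H 𝔤) :
    ∃ n, χ.toLinear = latticeWeight Δ n := by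
  by_cases h0 : χ.IsZero
  · exact ⟨0, by rw [map_zero]; exact DFunLike.coe_injective h0⟩
  · obtain ⟨f, -, -, hf⟩ := Δ.exists_root_eq_sum_int ⟨χ, by simpa using h0⟩
    refine ⟨fun i => f i, hf.trans ?_⟩
    rw [← Finset.sum_coe_sort]
    rfl

lemma iSup_gradedPiece : ⨆ k, gradedPiece Δ k = ⊤ := by
  have htop := congrArg LieSubmodule.toSubmodule (iSup_genWeightSpace_eq_top' ℂ H 𝔤)
  rw [LieSubmodule.iSup_toSubmodule, LieSubmodule.top_toSubmodule] at htop
  rw [eq_top_iff, ← htop]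
  refine iSup_le fun χ => ?_
  obtain ⟨n, hn⟩ := exists_latticeWeight_eq Δ χ
  rw [show (χ : H → ℂ) = ⇑(latticeWeight Δ n) from congrArg DFunLike.coe hn]
  exact (rootSpace_latticeWeight_le Δ n).trans (le_iSup _ _)

lemma exists_filtration_eq_top : ∃ N : ℕ, filtration Δ (-N) = ⊤ := by
  obtain ⟨N, hN⟩ := exists_gradedPiece_eq_bot Δ
  refine ⟨N, eq_top_iff.mpr ?_⟩
  rw [← iSup_gradedPiece Δ]
  refine iSup_le fun k => ?_
  by_cases hk : (N : ℤ) < |k|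
  · exact (hN k hk).trans_le bot_le
  · exact gradedPiece_le_filtration Δ (by have := neg_abs_le k; omega)

lemma rootSpace_simpleRoot_sub_eq_bot {i j : Δ.support} (hij : i ≠ j) :
    rootSpace H ⇑(simpleRoot Δ i - simpleRoot Δ j) = ⊥ := by
  classical
  rw [← latticeWeight_single, ← latticeWeight_single, ← map_sub]
  by_contra hb
  rcases nonneg_or_nonpos_of_rootSpace_ne_bot Δ hb with h | h
  · simpa [hij.symm] using h j
  · simpa [hij] using h i

/-- Generators `eᵢ ∈ 𝔤^{αᵢ}` and `fᵢ ∈ 𝔤^{-αᵢ}` with `[eᵢ, fⱼ] = δᵢⱼ αᵢ^∨`. -/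
structure ChevalleyGenerators where
  e : Δ.support → 𝔤
  f : Δ.support → 𝔤
  e_mem : ∀ i, e i ∈ rootSpace H ⇑(simpleRoot Δ i)
  f_mem : ∀ i, f i ∈ rootSpace H ⇑(-simpleRoot Δ i)
  f_ne_zero : ∀ i, f i ≠ 0
  lie_e_f : ∀ i, ⁅e i, f i⁆ = (Δ.toCoweightBasis i : H)
  lie_e_f_of_ne : ∀ i j, i ≠ j → ⁅e i, f j⁆ = 0

lemma finrank_rootSpace_neg_simpleRoot (i : Δ.support) :
    Module.finrank ℂ (rootSpace H ⇑(-simpleRoot Δ i)) = 1 :=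
  IsKilling.finrank_rootSpace_eq_one (-(i.1.1 : Weight ℂ H 𝔤))
    (LieSubalgebra.isNonZero_coe_root i.1).neg

variable {Δ} in
lemma ChevalleyGenerators.rootSpace_neg_eq_span (c : ChevalleyGenerators Δ) (i : Δ.support) :
    (rootSpace H ⇑(-simpleRoot Δ i)).toSubmodule = ℂ ∙ c.f i := by
  refine (Submodule.eq_of_le_of_finrank_eq
    ((Submodule.span_singleton_le_iff_mem _ _).mpr (c.f_mem i)) ?_).symm
  rw [finrank_span_singleton (c.f_ne_zero i)]
  exact (finrank_rootSpace_neg_simpleRoot Δ i).symm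

lemma nonempty_chevalleyGenerators : Nonempty (ChevalleyGenerators Δ) := by
  have hnz (i : Δ.support) : (i.1.1 : Weight ℂ H 𝔤).IsNonZero :=
    LieSubalgebra.isNonZero_coe_root i.1
  choose h e f hsl he hf using fun i : Δ.support =>
    IsKilling.exists_isSl2Triple_of_weight_isNonZero (hnz i)
  refine ⟨⟨e, f, he, hf, fun i => (hsl i).f_ne_zero, fun i => ?_, fun i j hij => ?_⟩⟩
  · rw [(hsl i).lie_e_f, (hsl i).h_eq_coroot (hnz i) (he i) (hf i)]
    simp
  · have hmem : ⁅e i, f j⁆ ∈ rootSpace H ⇑(simpleRoot Δ i - simpleRoot Δ j) := by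
      rw [sub_eq_add_neg]
      exact lie_mem_genWeightSpace_of_mem_genWeightSpace (he i) (hf j)
    rwa [rootSpace_simpleRoot_sub_eq_bot Δ hij, LieSubmodule.mem_bot] at hmem

end PrincipalGrading

/-! ### Inner automorphisms and the Borel subgroup -/

section GeneralLinearGroup

variable {R V : Type*} [CommRing R] [AddCommGroup V] [Module R V]

lemma inv_val_apply_val (σ : LinearMap.GeneralLinearGroup R V) (v : V) : σ⁻¹.1 (σ.1 v) = v := by
  rw [← Module.End.mul_apply, ← Units.val_mul, inv_mul_cancel, Units.val_one, Module.End.one_apply]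

lemma val_apply_inv_val (σ : LinearMap.GeneralLinearGroup R V) (v : V) : σ.1 (σ⁻¹.1 v) = v := by
  rw [← Module.End.mul_apply, ← Units.val_mul, mul_inv_cancel, Units.val_one, Module.End.one_apply]

lemma inv_val_mem_of_mapsTo {K V : Type*} [Field K] [AddCommGroup V] [Module K V]
    [FiniteDimensional K V] {σ : LinearMap.GeneralLinearGroup K V} {W : Submodule K V}
    (hσ : ∀ x ∈ W, σ.1 x ∈ W) {x : V} (hx : x ∈ W) : σ⁻¹.1 x ∈ W := by
  have hinj : Function.Injective σ.1 := Function.LeftInverse.injective (inv_val_apply_val σ)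
  have hmap : W.map σ.1 = W :=
    Submodule.eq_of_le_of_finrank_eq (Submodule.map_le_iff_le_comap.mpr hσ)
      (Submodule.equivMapOfInjective σ.1 hinj W).finrank_eq.symm
  rw [← hmap] at hx
  obtain ⟨y, hy, rfl⟩ := hx
  rwa [inv_val_apply_val]

end GeneralLinearGroup

section InnerAutomorphisms

variable {𝔤 : Type*} [LieRing 𝔤] [LieAlgebra ℂ 𝔤]

lemma IsExpAd.map_lie {x : 𝔤} {σ : LinearMap.GeneralLinearGroup ℂ 𝔤} (h : IsExpAd x σ)
    (y z : 𝔤) : σ.1 ⁅y, z⁆ = ⁅σ.1 y, σ.1 z⁆ := by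
  obtain ⟨k, hk, hσ⟩ := h
  -- the exponential of a nilpotent derivation is only available over `ℚ`
  let _ : Module ℚ 𝔤 := Module.compHom 𝔤 (algebraMap ℚ ℂ)
  let _ : LieAlgebra ℚ 𝔤 := { lie_smul := fun t x y => lie_smul (algebraMap ℚ ℂ t) x y }
  have had : (LieDerivation.ad ℂ 𝔤 x).toLinearMap = LieAlgebra.ad ℂ 𝔤 x := by
    ext y
    simp
  have hnil : IsNilpotent (LieDerivation.ad ℂ 𝔤 x).toLinearMap := ⟨k, had ▸ hk⟩
  have hexp : σ.1 = IsNilpotent.exp (LieDerivation.ad ℂ 𝔤 x).toLinearMap := by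
    rw [had, IsNilpotent.exp_eq_sum hk, hσ]
    refine Finset.sum_congr rfl fun n _ => ?_
    ext v
    change (n.factorial : ℂ)⁻¹ • (LieAlgebra.ad ℂ 𝔤 x ^ n) v =
      algebraMap ℚ ℂ (n.factorial : ℚ)⁻¹ • (LieAlgebra.ad ℂ 𝔤 x ^ n) v
    rw [map_inv₀, map_natCast]
  rw [hexp]
  exact (LieDerivation.exp (LieDerivation.ad ℂ 𝔤 x) hnil).map_lie y z

lemma map_lie_of_mem_adjointGroup {σ : LinearMap.GeneralLinearGroup ℂ 𝔤}
    (h : σ ∈ adjointGroup 𝔤) (y z : 𝔤) : σ.1 ⁅y, z⁆ = ⁅σ.1 y, σ.1 z⁆ := by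
  induction h using Subgroup.closure_induction generalizing y z with
  | mem σ h =>
    obtain ⟨x, hx⟩ := h
    exact hx.map_lie y z
  | one => simp
  | mul σ τ _ _ hσ hτ => simp only [Units.val_mul, Module.End.mul_apply, hσ, hτ]
  | inv σ _ hσ =>
    rw [← inv_val_apply_val σ ⁅σ⁻¹.1 y, σ⁻¹.1 z⁆, hσ, val_apply_inv_val, val_apply_inv_val]

end InnerAutomorphisms

section Borel

open LieAlgebra

variable {𝔤 : Type*} [LieRing 𝔤] [LieAlgebra ℂ 𝔤] [FiniteDimensional ℂ 𝔤]
  [LieAlgebra.IsSemisimple ℂ 𝔤]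
  {H : LieSubalgebra ℂ 𝔤} [H.IsCartanSubalgebra]
  (Δ : (LieAlgebra.IsKilling.rootSystem H).Base)

lemma mem_rootSpace_of_mem_cartanSubgroup {σ : LinearMap.GeneralLinearGroup ℂ 𝔤}
    (hσ : σ ∈ cartanSubgroup H) {χ : H → ℂ} {x : 𝔤} (hx : x ∈ rootSpace H χ) :
    σ.1 x ∈ rootSpace H χ := by
  refine (LieModule.mem_genWeightSpace _ _ _).mpr fun h => ⟨1, ?_⟩
  have hlie : ⁅(h : 𝔤), σ.1 x⁆ = χ h • σ.1 x := by
    rw [← map_smul, ← IsKilling.lie_eq_smul_of_mem_rootSpace hx h,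
      LieSubalgebra.coe_bracket_of_module, map_lie_of_mem_adjointGroup hσ.1, hσ.2 h h.2]
  rw [pow_one, LinearMap.sub_apply, LieModule.toEnd_apply_apply, LinearMap.smul_apply,
    Module.End.one_apply, sub_eq_zero]
  exact hlie

lemma mem_filtration_of_mem_cartanSubgroup {σ : LinearMap.GeneralLinearGroup ℂ 𝔤}
    (hσ : σ ∈ cartanSubgroup H) {k : ℤ} {x : 𝔤} (hx : x ∈ filtration Δ k) :
    σ.1 x ∈ filtration Δ k := by
  suffices h : filtration Δ k ≤ (filtration Δ k).comap σ.1 from h hx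
  refine iSup₂_le fun r hr => gradedPiece_le Δ fun n hn x hx => ?_
  refine gradedPiece_le_filtration Δ hr ?_
  rw [← hn]
  exact rootSpace_latticeWeight_le Δ n (mem_rootSpace_of_mem_cartanSubgroup hσ hx)

lemma ad_pow_apply_mem_filtration {x y : 𝔤} {k : ℤ} (hx : x ∈ filtration Δ 1)
    (hy : y ∈ filtration Δ k) (n : ℕ) : (ad ℂ 𝔤 x ^ n) y ∈ filtration Δ (k + n) := by
  induction n with
  | zero => simpa using hy
  | succ n ih =>
    rw [pow_succ', Module.End.mul_apply, ad_apply,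
      show k + (n + 1 : ℕ) = 1 + (k + n) by push_cast; ring]
    exact lie_mem_filtration Δ hx ih

lemma IsExpAd.sub_mem_filtration {x : 𝔤} (hx : x ∈ filtration Δ 1)
    {σ : LinearMap.GeneralLinearGroup ℂ 𝔤} (h : IsExpAd x σ) {k : ℤ} {y : 𝔤}
    (hy : y ∈ filtration Δ k) : σ.1 y - y ∈ filtration Δ (k + 1) := by
  obtain ⟨_ | N, hN, hσ⟩ := h
  · have hy0 : y = 0 := by simpa using congr($hN y)
    simp [hy0]
  · rw [hσ, Finset.sum_range_succ', LinearMap.add_apply, LinearMap.sum_apply]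
    simp only [pow_zero, Nat.factorial_zero, Nat.cast_one, inv_one, one_smul,
      Module.End.one_apply, add_sub_cancel_right, LinearMap.smul_apply]
    refine sum_mem fun n _ => Submodule.smul_mem _ _ ?_
    exact filtration_antitone Δ (by push_cast; omega) (ad_pow_apply_mem_filtration Δ hx hy (n + 1))

lemma borelSubgroup_eq_closure : borelSubgroup Δ =
    Subgroup.closure (cartanSubgroup H ∪ {σ | ∃ x ∈ filtration Δ 1, IsExpAd x σ}) := by
  rw [Subgroup.closure_union, Subgroup.closure_eq, borelSubgroup]

-- `τ` is the image of `σ` in `B / [B, B]`, identified with the Cartan subgroup.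
lemma exists_sub_mem_filtration_of_mem_borelSubgroup {σ : LinearMap.GeneralLinearGroup ℂ 𝔤}
    (hσ : σ ∈ borelSubgroup Δ) :
    ∃ τ ∈ cartanSubgroup H, ∀ k, ∀ x ∈ filtration Δ k, σ.1 x - τ.1 x ∈ filtration Δ (k + 1) := by
  rw [borelSubgroup_eq_closure] at hσ
  induction hσ using Subgroup.closure_induction with
  | mem σ hσ =>
    rcases hσ with hσ | ⟨n, hn, hσ⟩
    · exact ⟨σ, hσ, fun k x _ => by simp⟩
    · exact ⟨1, one_mem _, fun k x hx => hσ.sub_mem_filtration Δ hn hx⟩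
  | one => exact ⟨1, one_mem _, fun k x _ => by simp⟩
  | mul σ σ' _ _ hσ hσ' =>
    obtain ⟨τ, hτ, hστ⟩ := hσ
    obtain ⟨τ', hτ', hστ'⟩ := hσ'
    refine ⟨τ * τ', mul_mem hτ hτ', fun k x hx => ?_⟩
    have hsplit : (σ * σ').1 x - (τ * τ').1 x =
        (σ.1 (σ'.1 x - τ'.1 x) - τ.1 (σ'.1 x - τ'.1 x)) + τ.1 (σ'.1 x - τ'.1 x) +
          (σ.1 (τ'.1 x) - τ.1 (τ'.1 x)) := by
      simp only [Units.val_mul, Module.End.mul_apply, map_sub]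
      abel
    rw [hsplit]
    exact add_mem (add_mem (filtration_antitone Δ (by omega) (hστ _ _ (hστ' k x hx)))
      (mem_filtration_of_mem_cartanSubgroup Δ hτ (hστ' k x hx)))
      (hστ _ _ (mem_filtration_of_mem_cartanSubgroup Δ hτ' hx))
  | inv σ _ hσ =>
    obtain ⟨τ, hτ, hστ⟩ := hσ
    have hinv (k : ℤ) {x : 𝔤} (hx : x ∈ filtration Δ k) : σ⁻¹.1 x ∈ filtration Δ k := by
      refine inv_val_mem_of_mapsTo (fun x hx => ?_) hx
      rw [← sub_add_cancel (σ.1 x) (τ.1 x)]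
      exact add_mem (filtration_antitone Δ (by omega) (hστ k x hx))
        (mem_filtration_of_mem_cartanSubgroup Δ hτ hx)
    refine ⟨τ⁻¹, inv_mem hτ, fun k x hx => ?_⟩
    have hx' := mem_filtration_of_mem_cartanSubgroup Δ (inv_mem hτ) hx
    have hmem := neg_mem (hinv _ (hστ k _ hx'))
    rwa [map_sub, inv_val_apply_val, val_apply_inv_val, neg_sub] at hmem

lemma mem_filtration_of_mem_borelSubgroup {σ : LinearMap.GeneralLinearGroup ℂ 𝔤}
    (hσ : σ ∈ borelSubgroup Δ) {k : ℤ} {x : 𝔤} (hx : x ∈ filtration Δ k) :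
    σ.1 x ∈ filtration Δ k := by
  obtain ⟨τ, hτ, hστ⟩ := exists_sub_mem_filtration_of_mem_borelSubgroup Δ hσ
  rw [← sub_add_cancel (σ.1 x) (τ.1 x)]
  exact add_mem (filtration_antitone Δ (by omega) (hστ k x hx))
    (mem_filtration_of_mem_cartanSubgroup Δ hτ hx)

lemma map_neg_simpleRoot_of_mem_borelSubgroup {σ : LinearMap.GeneralLinearGroup ℂ 𝔤}
    (hσ : σ ∈ borelSubgroup Δ) (i : Δ.support) {x : 𝔤}
    (hx : x ∈ rootSpace H ⇑(-simpleRoot Δ i)) :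
    σ.1 x ∈ (rootSpace H ⇑(-simpleRoot Δ i)).toSubmodule ⊔ filtration Δ 0 := by
  obtain ⟨τ, hτ, hστ⟩ := exists_sub_mem_filtration_of_mem_borelSubgroup Δ hσ
  have hx' : x ∈ filtration Δ (-1) :=
    gradedPiece_le_filtration Δ le_rfl (rootSpace_neg_simpleRoot_le Δ i hx)
  have hdiff := hστ (-1) x hx'
  rw [neg_add_cancel] at hdiff
  rw [← add_sub_cancel (τ.1 x) (σ.1 x)]
  exact add_mem (Submodule.mem_sup_left (mem_rootSpace_of_mem_cartanSubgroup hτ hx))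
    (Submodule.mem_sup_right hdiff)

lemma map_sub_self_mem_of_mem_borelSubgroup {σ : LinearMap.GeneralLinearGroup ℂ 𝔤}
    (hσ : σ ∈ borelSubgroup Δ) {h : 𝔤} (hh : h ∈ H) : σ.1 h - h ∈ filtration Δ 1 := by
  obtain ⟨τ, hτ, hστ⟩ := exists_sub_mem_filtration_of_mem_borelSubgroup Δ hσ
  have hh0 : h ∈ filtration Δ 0 :=
    gradedPiece_le_filtration Δ le_rfl (by rw [gradedPiece_zero]; exact hh)
  simpa [hτ.2 h hh] using hστ 0 h hh0

end Borel

/-! ### Points with values in a `ℂ`-algebra -/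

section BaseChange

variable {K R V V' : Type*} [CommRing K] [CommRing R] [Algebra K R] [AddCommGroup V] [Module K V]
  [AddCommGroup V'] [Module K V']

lemma baseChange_le_iff {W : Submodule K V} {N : Submodule R (R ⊗[K] V)} :
    W.baseChange R ≤ N ↔ ∀ x ∈ W, (1 : R) ⊗ₜ[K] x ∈ N := by
  rw [Submodule.baseChange_eq_span, Submodule.span_le]
  exact Set.forall_mem_image

lemma baseChange_sup (W W' : Submodule K V) :
    (W ⊔ W').baseChange R = W.baseChange R ⊔ W'.baseChange R := by
  refine le_antisymm (baseChange_le_iff.mpr fun x hx => ?_)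
    (sup_le (Submodule.baseChange_mono R le_sup_left) (Submodule.baseChange_mono R le_sup_right))
  obtain ⟨y, hy, z, hz, rfl⟩ := Submodule.mem_sup.mp hx
  rw [TensorProduct.tmul_add]
  exact Submodule.add_mem_sup (Submodule.tmul_mem_baseChange_of_mem 1 hy)
    (Submodule.tmul_mem_baseChange_of_mem 1 hz)

lemma baseChange_apply_mem {f : V →ₗ[K] V'} {W : Submodule K V} {W' : Submodule K V'}
    (hf : ∀ x ∈ W, f x ∈ W') {y : R ⊗[K] V} (hy : y ∈ W.baseChange R) :
    f.baseChange R y ∈ W'.baseChange R := by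
  suffices h : W.baseChange R ≤ (W'.baseChange R).comap (f.baseChange R) from h hy
  refine baseChange_le_iff.mpr fun x hx => ?_
  rw [Submodule.mem_comap, LinearMap.baseChange_tmul]
  exact Submodule.tmul_mem_baseChange_of_mem 1 (hf x hx)

lemma rTensor_mem_baseChange {R' : Type*} [CommRing R'] [Algebra K R'] (g : R →ₗ[K] R')
    {W : Submodule K V} {y : R ⊗[K] V} (hy : y ∈ W.baseChange R) :
    g.rTensor V y ∈ W.baseChange R' := by
  obtain ⟨w, hw⟩ := W.toBaseChange_surjective R ⟨y, hy⟩
  obtain rfl : (W.toBaseChange R w : R ⊗[K] V) = y := congrArg Subtype.val hw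
  clear hw hy
  induction w with
  | zero => simp
  | tmul r x => exact Submodule.tmul_mem_baseChange_of_mem (g r) x.2
  | add w w' hw hw' =>
    rw [map_add, Submodule.coe_add, map_add]
    exact add_mem hw hw'

lemma lie_mem_baseChange {L : Type*} [LieRing L] [LieAlgebra K L] {U U' W : Submodule K L}
    (h : ∀ x ∈ U, ∀ y ∈ U', ⁅x, y⁆ ∈ W) {x y : R ⊗[K] L} (hx : x ∈ U.baseChange R)
    (hy : y ∈ U'.baseChange R) : ⁅x, y⁆ ∈ W.baseChange R := by
  suffices hU : U.baseChange R ≤ (W.baseChange R).comap (LieAlgebra.ad R _ y) by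
    rw [← lie_skew]
    exact neg_mem (hU hx)
  refine baseChange_le_iff.mpr fun a ha => ?_
  suffices hU' : U'.baseChange R ≤ (W.baseChange R).comap (LieAlgebra.ad R _ (1 ⊗ₜ a)) by
    rw [Submodule.mem_comap, LieAlgebra.ad_apply, ← lie_skew]
    exact neg_mem (hU' hy)
  refine baseChange_le_iff.mpr fun b hb => ?_
  rw [Submodule.mem_comap, LieAlgebra.ad_apply, LieAlgebra.ExtendScalars.bracket_tmul]
  exact Submodule.tmul_mem_baseChange_of_mem _ (h a ha b hb)

end BaseChange

section RPoints

variable {𝔤 : Type*} [AddCommGroup 𝔤] [Module ℂ 𝔤]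
variable {R : Type*} [CommRing R] [Algebra ℂ R]

lemma dualExt_baseChange (l : Module.Dual ℂ 𝔤) (f : 𝔤 →ₗ[ℂ] 𝔤) (y : R ⊗[ℂ] 𝔤) :
    dualExt R l (f.baseChange R y) = dualExt R (l ∘ₗ f) y := by
  suffices h : dualExt R l ∘ₗ f.baseChange R = dualExt R (l ∘ₗ f) from LinearMap.congr_fun h y
  ext x
  simp

lemma extMap_baseChange {R' : Type*} [CommRing R'] [Algebra ℂ R'] (ρ : R →ₐ[ℂ] R')
    (f : 𝔤 →ₗ[ℂ] 𝔤) (y : R ⊗[ℂ] 𝔤) :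
    extMap 𝔤 ρ (f.baseChange R y) = f.baseChange R' (extMap 𝔤 ρ y) := by
  induction y with
  | zero => simp
  | tmul a x => simp
  | add y z hy hz => simp only [map_add, hy, hz]

lemma eq_zero_of_smul_one_tmul_eq_zero {x : 𝔤} (hx : x ≠ 0) {r : R}
    (h : r • ((1 : R) ⊗ₜ[ℂ] x) = 0) : r = 0 := by
  obtain ⟨l, hl⟩ : ∃ l : Module.Dual ℂ 𝔤, l x ≠ 0 := by
    by_contra! hcon
    exact hx ((Module.forall_dual_apply_eq_zero_iff ℂ x).mp hcon)
  have hunit : IsUnit (algebraMap ℂ R (l x)) := (IsUnit.mk0 _ hl).map _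
  refine hunit.mul_left_eq_zero.mp ?_
  simpa using congrArg (dualExt R l) h

variable [FiniteDimensional ℂ 𝔤]

lemma eq_zero_of_dualExt {y : R ⊗[ℂ] 𝔤} (h : ∀ l, dualExt R l y = 0) : y = 0 := by
  rw [eq_sum_dualExt y]
  simp [h]

lemma mem_baseChange_of_dualExt {W : Submodule ℂ 𝔤} {y : R ⊗[ℂ] 𝔤}
    (h : ∀ l : Module.Dual ℂ 𝔤, (∀ w ∈ W, l w = 0) → dualExt R l y = 0) :
    y ∈ W.baseChange R := by
  obtain ⟨p, hp⟩ := W.subtype.exists_leftInverse_of_injective W.ker_subtype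
  have hpW (w : 𝔤) (hw : w ∈ W) : (W.subtype ∘ₗ p) w = w :=
    congrArg Subtype.val (LinearMap.congr_fun hp ⟨w, hw⟩)
  have hy : (W.subtype ∘ₗ p).baseChange R y = y := by
    refine sub_eq_zero.mp (eq_zero_of_dualExt fun l => ?_)
    have hl := h (l ∘ₗ (W.subtype ∘ₗ p) - l) fun w hw => by
      rw [LinearMap.sub_apply, LinearMap.comp_apply, hpW w hw, sub_self]
    have hsub : dualExt R (l ∘ₗ (W.subtype ∘ₗ p) - l) =
        dualExt R (l ∘ₗ (W.subtype ∘ₗ p)) - dualExt R l := by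
      ext x
      simp
    rwa [hsub, LinearMap.sub_apply, ← dualExt_baseChange, ← map_sub] at hl
  rw [← hy]
  refine baseChange_apply_mem (W := ⊤) (fun x _ => (p x).2) ?_
  rw [Submodule.baseChange_top]
  exact Submodule.mem_top

lemma points_map_sub_mem {S : Subgroup (LinearMap.GeneralLinearGroup ℂ 𝔤)} {x x₀ : 𝔤}
    {W : Submodule ℂ 𝔤} (h : ∀ σ ∈ S, σ.1 x - x₀ ∈ W)
    {φ : LinearMap.GeneralLinearGroup R (R ⊗[ℂ] 𝔤)} (hφ : φ ∈ points S R) :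
    φ.1 (1 ⊗ₜ x) - 1 ⊗ₜ x₀ ∈ W.baseChange R := by
  refine mem_baseChange_of_dualExt fun l hl => ?_
  have hvanish : VanishesOn S (MvPolynomial.X (.inl (x, l)) - MvPolynomial.C (l x₀)) := by
    intro σ hσ
    simpa [coordC, map_sub] using hl _ (h σ hσ)
  simpa [coord, map_sub] using hφ _ hvanish

lemma points_map_mem {S : Subgroup (LinearMap.GeneralLinearGroup ℂ 𝔤)} {x : 𝔤}
    {W : Submodule ℂ 𝔤} (h : ∀ σ ∈ S, σ.1 x ∈ W)
    {φ : LinearMap.GeneralLinearGroup R (R ⊗[ℂ] 𝔤)} (hφ : φ ∈ points S R) :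
    φ.1 (1 ⊗ₜ x) ∈ W.baseChange R := by
  simpa using points_map_sub_mem (x₀ := 0) (by simpa using h) hφ

lemma points_map_mem_baseChange {S : Subgroup (LinearMap.GeneralLinearGroup ℂ 𝔤)}
    {W W' : Submodule ℂ 𝔤} (h : ∀ σ ∈ S, ∀ x ∈ W, σ.1 x ∈ W')
    {φ : LinearMap.GeneralLinearGroup R (R ⊗[ℂ] 𝔤)} (hφ : φ ∈ points S R) {y : R ⊗[ℂ] 𝔤}
    (hy : y ∈ W.baseChange R) : φ.1 y ∈ W'.baseChange R := by
  suffices hle : W.baseChange R ≤ (W'.baseChange R).comap φ.1 from hle hy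
  exact baseChange_le_iff.mpr fun x hx => points_map_mem (fun σ hσ => h σ hσ x hx) hφ

end RPoints

section LiePoints

variable {𝔤 : Type*} [LieRing 𝔤] [LieAlgebra ℂ 𝔤] [FiniteDimensional ℂ 𝔤]
variable {R : Type*} [CommRing R] [Algebra ℂ R]

lemma dualExt_lie (l : Module.Dual ℂ 𝔤) (y z : R ⊗[ℂ] 𝔤) :
    dualExt R l ⁅y, z⁆ = ∑ j, ∑ k, dualExt R ((Module.finBasis ℂ 𝔤).coord j) y *
      dualExt R ((Module.finBasis ℂ 𝔤).coord k) z *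
        algebraMap ℂ R (l ⁅Module.finBasis ℂ 𝔤 j, Module.finBasis ℂ 𝔤 k⁆) := by
  conv_lhs => rw [eq_sum_dualExt y, eq_sum_dualExt z]
  rw [sum_lie_sum]
  simp only [map_sum, LieAlgebra.ExtendScalars.bracket_tmul, dualExt_tmul]

lemma dual_lie (l : Module.Dual ℂ 𝔤) (y z : 𝔤) :
    l ⁅y, z⁆ = ∑ j, ∑ k, (Module.finBasis ℂ 𝔤).coord j y * (Module.finBasis ℂ 𝔤).coord k z *
      l ⁅Module.finBasis ℂ 𝔤 j, Module.finBasis ℂ 𝔤 k⁆ := by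
  simpa using dualExt_lie l ((1 : ℂ) ⊗ₜ[ℂ] y) (1 ⊗ₜ z)

lemma points_map_one_tmul_lie {S : Subgroup (LinearMap.GeneralLinearGroup ℂ 𝔤)}
    (h : ∀ σ ∈ S, ∀ x y : 𝔤, σ.1 ⁅x, y⁆ = ⁅σ.1 x, σ.1 y⁆)
    {φ : LinearMap.GeneralLinearGroup R (R ⊗[ℂ] 𝔤)} (hφ : φ ∈ points S R) (x y : 𝔤) :
    φ.1 (1 ⊗ₜ ⁅x, y⁆) = ⁅φ.1 (1 ⊗ₜ x), φ.1 (1 ⊗ₜ y)⁆ := by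
  refine sub_eq_zero.mp (eq_zero_of_dualExt fun l => ?_)
  have hvanish : VanishesOn S (MvPolynomial.X (.inl (⁅x, y⁆, l)) - ∑ j, ∑ k,
      MvPolynomial.X (.inl (x, (Module.finBasis ℂ 𝔤).coord j)) *
      MvPolynomial.X (.inl (y, (Module.finBasis ℂ 𝔤).coord k)) *
        MvPolynomial.C (l ⁅Module.finBasis ℂ 𝔤 j, Module.finBasis ℂ 𝔤 k⁆)) := by
    intro σ hσ
    simp only [map_sub, MvPolynomial.aeval_X, coordC, map_sum, map_mul, MvPolynomial.aeval_C]
    rw [h σ hσ, sub_eq_zero]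
    exact dual_lie l (σ.1 x) (σ.1 y)
  have heval := hφ _ hvanish
  simp only [map_sub, MvPolynomial.aeval_X, coord, map_sum, map_mul, MvPolynomial.aeval_C] at heval
  rw [map_sub, dualExt_lie]
  exact heval

lemma points_map_lie {S : Subgroup (LinearMap.GeneralLinearGroup ℂ 𝔤)}
    (h : ∀ σ ∈ S, ∀ x y : 𝔤, σ.1 ⁅x, y⁆ = ⁅σ.1 x, σ.1 y⁆)
    {φ : LinearMap.GeneralLinearGroup R (R ⊗[ℂ] 𝔤)} (hφ : φ ∈ points S R)
    (y z : R ⊗[ℂ] 𝔤) : φ.1 ⁅y, z⁆ = ⁅φ.1 y, φ.1 z⁆ := by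
  induction y with
  | zero => simp
  | add a b ha hb => simp only [add_lie, map_add, ha, hb]
  | tmul r x =>
    induction z with
    | zero => simp
    | add a b ha hb => simp only [lie_add, map_add, ha, hb]
    | tmul s y =>
      rw [TensorProduct.tmul_eq_smul_one_tmul r, TensorProduct.tmul_eq_smul_one_tmul s]
      simp only [smul_lie, lie_smul, map_smul, LieAlgebra.ExtendScalars.bracket_tmul, mul_one,
        points_map_one_tmul_lie h hφ]

end LiePoints

/-! ### The principal grading over a `ℂ`-algebra -/

section Sl2

variable {R : Type*} [CommRing R] [Algebra ℂ R]

lemma isUnit_intCast {n : ℤ} (hn : n ≠ 0) : IsUnit (n : R) := by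
  have h : IsUnit (n : ℂ) := IsUnit.mk0 _ (by exact_mod_cast hn)
  simpa using h.map (algebraMap ℂ R)

lemma eq_zero_of_lowest_weight_pos {L : Type*} [LieRing L] [LieAlgebra R L] {h e f y : L}
    (hef : ⁅e, f⁆ = h) (he : ⁅h, e⁆ = 2 • e) (hf : ⁅h, f⁆ = -(2 • f)) {k : ℤ} (hk : 0 < k)
    (hy : ⁅h, y⁆ = (k : R) • y) (hfy : ⁅f, y⁆ = 0) {N : ℕ}
    (hN : (LieModule.toEnd R L L e ^ N) y = 0) : y = 0 := by
  by_contra hne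
  have hh : h ≠ 0 := by
    rintro rfl
    rw [zero_lie] at hy
    exact hne ((isUnit_intCast hk.ne').smul_eq_zero.mp hy.symm)
  have t : IsSl2Triple h e f := ⟨hh, hef, he, hf⟩
  have P : t.symm.HasPrimitiveVectorWith y (-(k : R)) := ⟨hne, by rw [neg_lie, hy, neg_smul], hfy⟩
  induction N with
  | zero => exact hne (by simpa using hN)
  | succ N ih =>
    refine ih ?_
    have hstep := P.lie_e_pow_succ_toEnd_f N
    have hcoeff : ((N : R) + 1) * (-(k : R) - N) = ((((N : ℤ) + 1) * (-k - N) : ℤ) : R) := by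
      push_cast
      ring
    rw [hN, lie_zero, hcoeff] at hstep
    exact (isUnit_intCast (mul_ne_zero (by omega) (by omega))).smul_eq_zero.mp hstep.symm

end Sl2

section ScalarExtension

open LieAlgebra

variable {𝔤 : Type*} [LieRing 𝔤] [LieAlgebra ℂ 𝔤] [FiniteDimensional ℂ 𝔤]
  [LieAlgebra.IsSemisimple ℂ 𝔤]
  {H : LieSubalgebra ℂ 𝔤} [H.IsCartanSubalgebra]
  (Δ : (LieAlgebra.IsKilling.rootSystem H).Base)
  (R : Type*) [CommRing R] [Algebra ℂ R]

/-- The homogeneous component `R ⊗ 𝔤_k` of `R ⊗ 𝔤`. -/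
def gradedPieceExt (k : ℤ) : Submodule R (R ⊗[ℂ] 𝔤) := (gradedPiece Δ k).baseChange R

/-- The filtration `R ⊗ 𝔤^k` of `R ⊗ 𝔤`. -/
def filtrationExt (k : ℤ) : Submodule R (R ⊗[ℂ] 𝔤) := (filtration Δ k).baseChange R

/-- The element `ρ^∨` of `R ⊗ 𝔤`, which acts on `R ⊗ 𝔤_k` as multiplication by `k`. -/
def gradingElementExt : R ⊗[ℂ] 𝔤 := 1 ⊗ₜ (gradingElement Δ : 𝔤)

lemma exists_filtrationExt_eq_bot : ∃ N : ℕ, filtrationExt Δ R N = ⊥ := by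
  obtain ⟨N, hN⟩ := exists_filtration_eq_bot Δ
  exact ⟨N, by rw [filtrationExt, hN, Submodule.baseChange_bot]⟩

lemma exists_filtrationExt_eq_top : ∃ N : ℕ, filtrationExt Δ R (-N) = ⊤ := by
  obtain ⟨N, hN⟩ := exists_filtration_eq_top Δ
  exact ⟨N, by rw [filtrationExt, hN, Submodule.baseChange_top]⟩

variable {Δ R}

lemma filtrationExt_antitone : Antitone (filtrationExt Δ R) := fun _ _ h =>
  Submodule.baseChange_mono R (filtration_antitone Δ h)

lemma mem_filtrationExt_of_le {j k : ℤ} (h : j ≤ k) {x : R ⊗[ℂ] 𝔤}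
    (hx : x ∈ filtrationExt Δ R k) : x ∈ filtrationExt Δ R j :=
  filtrationExt_antitone h hx

lemma gradedPieceExt_le_filtrationExt {j k : ℤ} (h : k ≤ j) :
    gradedPieceExt Δ R j ≤ filtrationExt Δ R k :=
  Submodule.baseChange_mono R (gradedPiece_le_filtration Δ h)

lemma filtrationExt_eq_sup (k : ℤ) :
    filtrationExt Δ R k = gradedPieceExt Δ R k ⊔ filtrationExt Δ R (k + 1) := by
  rw [filtrationExt, filtration_eq_sup, baseChange_sup, gradedPieceExt, filtrationExt]

lemma tmul_mem_gradedPieceExt {k : ℤ} (r : R) {x : 𝔤} (hx : x ∈ gradedPiece Δ k) :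
    r ⊗ₜ[ℂ] x ∈ gradedPieceExt Δ R k :=
  Submodule.tmul_mem_baseChange_of_mem r hx

lemma gradingElementExt_mem : gradingElementExt Δ R ∈ gradedPieceExt Δ R 0 :=
  tmul_mem_gradedPieceExt 1 (by rw [gradedPiece_zero]; exact (gradingElement Δ).2)

lemma lie_mem_gradedPieceExt {j k : ℤ} {x y : R ⊗[ℂ] 𝔤} (hx : x ∈ gradedPieceExt Δ R j)
    (hy : y ∈ gradedPieceExt Δ R k) : ⁅x, y⁆ ∈ gradedPieceExt Δ R (j + k) :=
  lie_mem_baseChange (fun _ hx _ hy => lie_mem_gradedPiece Δ hx hy) hx hy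

lemma lie_mem_filtrationExt {j k l : ℤ} (h : l ≤ j + k) {x y : R ⊗[ℂ] 𝔤}
    (hx : x ∈ filtrationExt Δ R j) (hy : y ∈ filtrationExt Δ R k) :
    ⁅x, y⁆ ∈ filtrationExt Δ R l :=
  mem_filtrationExt_of_le h (lie_mem_baseChange (fun _ hx _ hy => lie_mem_filtration Δ hx hy) hx hy)

lemma lie_gradingElementExt {k : ℤ} {x : R ⊗[ℂ] 𝔤} (hx : x ∈ gradedPieceExt Δ R k) :
    ⁅gradingElementExt Δ R, x⁆ = (k : R) • x := by
  suffices h : gradedPieceExt Δ R k ≤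
      LinearMap.eqLocus (ad R _ (gradingElementExt Δ R)) ((k : R) • LinearMap.id) from h hx
  refine baseChange_le_iff.mpr fun y hy => ?_
  rw [LinearMap.mem_eqLocus, ad_apply, gradingElementExt, ExtendScalars.bracket_tmul,
    lie_gradingElement Δ hy, mul_one, LinearMap.smul_apply, LinearMap.id_apply,
    TensorProduct.tmul_smul, TensorProduct.smul_tmul', TensorProduct.smul_tmul', Algebra.smul_def,
    map_intCast, smul_eq_mul]

lemma mem_filtrationExt_of_lie_sub_mem {j l m : ℤ} (hlm : l ≤ m)
    (hj : ∀ i, l ≤ i → i < m → i ≠ j) {x : R ⊗[ℂ] 𝔤} (hx : x ∈ filtrationExt Δ R l)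
    (h : ⁅gradingElementExt Δ R, x⁆ - (j : R) • x ∈ filtrationExt Δ R m) :
    x ∈ filtrationExt Δ R m := by
  suffices ∀ i, l ≤ i → i ≤ m → x ∈ filtrationExt Δ R i from this m hlm le_rfl
  intro i hi
  induction i, hi using Int.leInduction with
  | base => exact fun _ => hx
  | succ i hi ih =>
    intro him
    have hxi := ih (by omega)
    rw [filtrationExt_eq_sup] at hxi
    obtain ⟨a, ha, b, hb, rfl⟩ := Submodule.mem_sup.mp hxi
    have hρb : ⁅gradingElementExt Δ R, b⁆ ∈ filtrationExt Δ R (i + 1) :=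
      lie_mem_filtrationExt (by omega)
        (gradedPieceExt_le_filtrationExt le_rfl gradingElementExt_mem) hb
    have hleading : ⁅gradingElementExt Δ R, a + b⁆ - (j : R) • (a + b) -
        (⁅gradingElementExt Δ R, b⁆ - (j : R) • b) = ((i - j : ℤ) : R) • a := by
      rw [lie_add, lie_gradingElementExt ha, Int.cast_sub, sub_smul, smul_add]
      abel
    have hmem := sub_mem (mem_filtrationExt_of_le him h)
      (sub_mem hρb (Submodule.smul_mem _ (j : R) hb))
    rw [hleading] at hmem
    have hunit : IsUnit ((i - j : ℤ) : R) := isUnit_intCast (sub_ne_zero.mpr (hj i hi (by omega)))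
    exact add_mem ((Submodule.smul_mem_iff_of_isUnit _ hunit).mp hmem) hb

lemma eq_zero_of_forall_mem_filtrationExt {x : R ⊗[ℂ] 𝔤} {l : ℤ}
    (h : ∀ k, l ≤ k → x ∈ filtrationExt Δ R k) : x = 0 := by
  obtain ⟨N, hN⟩ := exists_filtrationExt_eq_bot Δ R
  rw [← Submodule.mem_bot R, ← hN]
  exact mem_filtrationExt_of_le (le_max_right l N) (h _ (le_max_left _ _))

lemma eq_zero_of_mem_gradedPieceExt_of_mem_filtrationExt {j l : ℤ} (hjl : j < l) {x : R ⊗[ℂ] 𝔤}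
    (hx : x ∈ gradedPieceExt Δ R j) (hxl : x ∈ filtrationExt Δ R l) : x = 0 := by
  refine eq_zero_of_forall_mem_filtrationExt (Δ := Δ) (l := l) fun k hk => ?_
  refine mem_filtrationExt_of_lie_sub_mem (j := j) hk (fun i hi _ => by omega) hxl ?_
  rw [lie_gradingElementExt hx, sub_self]
  exact zero_mem _

lemma exists_toEnd_pow_apply_eq_zero {d k : ℤ} (hd : d ≠ 0) {a x : R ⊗[ℂ] 𝔤}
    (ha : a ∈ gradedPieceExt Δ R d) (hx : x ∈ gradedPieceExt Δ R k) :
    ∃ n : ℕ, (LieModule.toEnd R (R ⊗[ℂ] 𝔤) (R ⊗[ℂ] 𝔤) a ^ n) x = 0 := by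
  have hpow (n : ℕ) : (LieModule.toEnd R (R ⊗[ℂ] 𝔤) (R ⊗[ℂ] 𝔤) a ^ n) x ∈
      gradedPieceExt Δ R (k + n * d) := by
    induction n with
    | zero => simpa using hx
    | succ n ih =>
      rw [pow_succ', Module.End.mul_apply, LieModule.toEnd_apply_apply,
        show k + (n + 1 : ℕ) * d = d + (k + n * d) by push_cast; ring]
      exact lie_mem_gradedPieceExt ha ih
  obtain ⟨N, hN⟩ := exists_gradedPiece_eq_bot Δ
  refine ⟨N + k.natAbs + 1, ?_⟩
  have hdeg : (N : ℤ) < |k + (N + k.natAbs + 1 : ℕ) * d| := by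
    have hd1 : 1 ≤ |d| := Int.one_le_abs hd
    have htri := abs_sub_abs_le_abs_add ((N + k.natAbs + 1 : ℕ) * d) k
    rw [abs_mul, Nat.abs_cast, add_comm _ k] at htri
    have hk : (k.natAbs : ℤ) = |k| := Int.natCast_natAbs k
    push_cast [hk] at htri ⊢
    nlinarith [abs_nonneg k]
  have hmem := hpow (N + k.natAbs + 1)
  rwa [gradedPieceExt, hN _ hdeg, Submodule.baseChange_bot, Submodule.mem_bot] at hmem

end ScalarExtension

section PrincipalTriple

open LieAlgebra

variable {𝔤 : Type*} [LieRing 𝔤] [LieAlgebra ℂ 𝔤] [FiniteDimensional ℂ 𝔤]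
  [LieAlgebra.IsSemisimple ℂ 𝔤]
  {H : LieSubalgebra ℂ 𝔤} [H.IsCartanSubalgebra]
  {Δ : (LieAlgebra.IsKilling.rootSystem H).Base}
  {R : Type*} [CommRing R] [Algebra ℂ R]

/-- The coefficients `cᵢ` with `2 ρ^∨ = ∑ cᵢ αᵢ^∨`. -/
def gradingCoeff (Δ : (LieAlgebra.IsKilling.rootSystem H).Base) (i : Δ.support) : ℂ :=
  Δ.toCoweightBasis.repr ((2 : ℂ) • gradingElement Δ) i

lemma sum_gradingCoeff_smul : ∑ i, gradingCoeff Δ i • ((Δ.toCoweightBasis i : H) : 𝔤) =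
    (2 : ℂ) • (gradingElement Δ : 𝔤) := by
  simpa [gradingCoeff] using congrArg (fun h : H => (h : 𝔤))
    (Δ.toCoweightBasis.sum_repr ((2 : ℂ) • gradingElement Δ))

namespace ChevalleyGenerators

variable (C : ChevalleyGenerators Δ) (u : Δ.support → Rˣ)

/-- The principal nilpotent element `∑ uᵢ fᵢ`. -/
def principalF : R ⊗[ℂ] 𝔤 := ∑ i, (u i : R) ⊗ₜ[ℂ] C.f i

/-- The element `∑ uᵢ⁻¹ cᵢ eᵢ`, which forms an `𝔰𝔩₂`-triple with `2 ρ^∨` and `∑ uᵢ fᵢ`. -/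
def principalE : R ⊗[ℂ] 𝔤 := ∑ i, ((u i)⁻¹ : Rˣ).1 ⊗ₜ[ℂ] (gradingCoeff Δ i • C.e i)

lemma principalF_mem : C.principalF u ∈ gradedPieceExt Δ R (-1) :=
  sum_mem fun i _ => tmul_mem_gradedPieceExt _ (rootSpace_neg_simpleRoot_le Δ i (C.f_mem i))

lemma principalE_mem : C.principalE u ∈ gradedPieceExt Δ R 1 :=
  sum_mem fun i _ => tmul_mem_gradedPieceExt _
    (Submodule.smul_mem _ _ (rootSpace_simpleRoot_le Δ i (C.e_mem i)))

lemma lie_gradingElementExt_principalF :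
    ⁅gradingElementExt Δ R, C.principalF u⁆ = -C.principalF u := by
  rw [lie_gradingElementExt (C.principalF_mem u), Int.cast_neg, Int.cast_one, neg_one_smul]

lemma lie_gradingElementExt_principalE :
    ⁅gradingElementExt Δ R, C.principalE u⁆ = C.principalE u := by
  rw [lie_gradingElementExt (C.principalE_mem u), Int.cast_one, one_smul]

lemma lie_principalE_principalF :
    ⁅C.principalE u, C.principalF u⁆ = 2 • gradingElementExt Δ R := by
  have h2ρ : 2 • gradingElementExt Δ R = (1 : R) ⊗ₜ[ℂ] ((2 : ℂ) • (gradingElement Δ : 𝔤)) := by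
    rw [gradingElementExt, two_smul, two_smul, TensorProduct.tmul_add]
  rw [h2ρ, ← sum_gradingCoeff_smul, principalE, principalF, sum_lie_sum, TensorProduct.tmul_sum]
  refine Finset.sum_congr rfl fun i _ => ?_
  rw [Finset.sum_eq_single i]
  · rw [ExtendScalars.bracket_tmul, smul_lie, C.lie_e_f, Units.inv_mul]
  · intro j _ hj
    rw [ExtendScalars.bracket_tmul, smul_lie, C.lie_e_f_of_ne i j hj.symm, smul_zero,
      TensorProduct.tmul_zero]
  · simp

lemma eq_zero_of_lie_principalF {k : ℤ} (hk : 0 < k) {x : R ⊗[ℂ] 𝔤}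
    (hx : x ∈ gradedPieceExt Δ R k) (h : ⁅C.principalF u, x⁆ = 0) : x = 0 := by
  obtain ⟨N, hN⟩ := exists_toEnd_pow_apply_eq_zero one_ne_zero (C.principalE_mem u) hx
  refine eq_zero_of_lowest_weight_pos (R := R) (C.lie_principalE_principalF u) ?_ ?_
    (k := 2 * k) (by omega) ?_ h hN
  · rw [nsmul_lie, C.lie_gradingElementExt_principalE]
  · rw [nsmul_lie, C.lie_gradingElementExt_principalF, smul_neg]
  · rw [nsmul_lie, lie_gradingElementExt hx, two_smul, ← add_smul, two_mul, Int.cast_add]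

lemma eq_zero_of_lie_principalE {k : ℤ} (hk : k < 0) {x : R ⊗[ℂ] 𝔤}
    (hx : x ∈ gradedPieceExt Δ R k) (h : ⁅C.principalE u, x⁆ = 0) : x = 0 := by
  obtain ⟨N, hN⟩ := exists_toEnd_pow_apply_eq_zero (by decide) (C.principalF_mem u) hx
  refine eq_zero_of_lowest_weight_pos (R := R) (h := -(2 • gradingElementExt Δ R)) ?_ ?_ ?_
    (k := -(2 * k)) (by omega) ?_ h hN
  · rw [← lie_skew, C.lie_principalE_principalF u]
  · rw [neg_lie, nsmul_lie, C.lie_gradingElementExt_principalF, smul_neg, neg_neg]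
  · rw [neg_lie, nsmul_lie, C.lie_gradingElementExt_principalE]
  · rw [neg_lie, nsmul_lie, lie_gradingElementExt hx, two_smul, ← add_smul, ← neg_smul, two_mul,
      Int.cast_neg, Int.cast_add]

end ChevalleyGenerators

end PrincipalTriple

/-! ### Rigidity of a connection with principal leading term -/

lemma eq_zero_of_forall_lie_one_tmul {K R L : Type*} [CommRing K] [CommRing R] [Algebra K R]
    [Module.Free K R] [LieRing L] [LieAlgebra K L] [LieModule.IsFaithful K L L] {a : R ⊗[K] L}
    (h : ∀ x : L, ⁅a, (1 : R) ⊗ₜ[K] x⁆ = 0) : a = 0 := by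
  let coeff := TensorProduct.equivFinsuppOfBasisLeft (N := L) (Module.Free.chooseBasis K R)
  have hcoeff (a : R ⊗[K] L) (x : L) (i) : coeff ⁅a, (1 : R) ⊗ₜ[K] x⁆ i = ⁅coeff a i, x⁆ := by
    induction a with
    | zero => simp
    | tmul r y => simp [coeff]
    | add a a' ha ha' => rw [add_lie, map_add, map_add, Finsupp.add_apply, ha, ha',
        Finsupp.add_apply, add_lie]
  refine coeff.map_eq_zero_iff.mp (Finsupp.ext fun i => ?_)
  suffices coeff a i ∈ LieAlgebra.center K L by
    rwa [LieAlgebra.center_eq_bot, LieSubmodule.mem_bot] at this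
  refine (LieModule.mem_maxTrivSubmodule K L L _).mpr fun x => ?_
  rw [← lie_skew, ← hcoeff, h, map_zero, Finsupp.zero_apply, neg_zero]

section Gauge

open LieAlgebra

variable {𝔤 : Type*} [LieRing 𝔤] [LieAlgebra ℂ 𝔤] [FiniteDimensional ℂ 𝔤]
  [LieAlgebra.IsSemisimple ℂ 𝔤]
  {H : LieSubalgebra ℂ 𝔤} [H.IsCartanSubalgebra]
  {Δ : (LieAlgebra.IsKilling.rootSystem H).Base}
  {R : Type*} [CommRing R] [Algebra ℂ R]

lemma filtrationExt_le_iff {k : ℤ} {N : Submodule R (R ⊗[ℂ] 𝔤)} :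
    filtrationExt Δ R k ≤ N ↔ ∀ r, k ≤ r → gradedPieceExt Δ R r ≤ N := by
  refine ⟨fun h r hr => (gradedPieceExt_le_filtrationExt hr).trans h, fun h => ?_⟩
  suffices hle : filtration Δ k ≤ (N.restrictScalars ℂ).comap (TensorProduct.mk ℂ R 𝔤 1) from
    baseChange_le_iff.mpr hle
  exact iSup₂_le fun r hr x hx => h r hr (tmul_mem_gradedPieceExt 1 hx)

lemma derExt_mem_filtrationExt (D : Derivation ℂ R R) {k : ℤ} {x : R ⊗[ℂ] 𝔤}
    (hx : x ∈ filtrationExt Δ R k) : derExt 𝔤 D x ∈ filtrationExt Δ R k :=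
  rTensor_mem_baseChange (D : R →ₗ[ℂ] R) hx

lemma mem_filtrationExt_of_forall_lie_mem {m : ℤ} {z : R ⊗[ℂ] 𝔤}
    (h : ∀ k, ∀ x ∈ filtrationExt Δ R k, ⁅z, x⁆ ∈ filtrationExt Δ R (m + k)) :
    z ∈ filtrationExt Δ R m := by
  obtain ⟨N, hN⟩ := exists_filtrationExt_eq_top Δ R
  suffices ∀ i, -(N : ℤ) ≤ i → i ≤ m → z ∈ filtrationExt Δ R i by
    rcases le_total (-(N : ℤ)) m with hm | hm
    · exact this m hm le_rfl
    · exact mem_filtrationExt_of_le hm (by rw [hN]; exact Submodule.mem_top)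
  intro i hi
  induction i, hi using Int.leInduction with
  | base => exact fun _ => by rw [hN]; exact Submodule.mem_top
  | succ i _ ih =>
    intro him
    have hzi := ih (by omega)
    rw [filtrationExt_eq_sup] at hzi
    obtain ⟨a, ha, z', hz', rfl⟩ := Submodule.mem_sup.mp hzi
    have hcomm (k : ℤ) (x : 𝔤) (hx : x ∈ gradedPiece Δ k) : ⁅a, (1 : R) ⊗ₜ[ℂ] x⁆ = 0 := by
      have hx1 : 1 ⊗ₜ x ∈ gradedPieceExt Δ R k := tmul_mem_gradedPieceExt 1 hx
      have hxk := gradedPieceExt_le_filtrationExt le_rfl hx1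
      refine eq_zero_of_mem_gradedPieceExt_of_mem_filtrationExt (l := i + 1 + k) (by omega)
        (lie_mem_gradedPieceExt ha hx1) ?_
      rw [← add_sub_cancel_right a z', sub_lie]
      exact sub_mem (mem_filtrationExt_of_le (by omega) (h k _ hxk))
        (lie_mem_filtrationExt le_rfl hz' hxk)
    suffices a = 0 by rwa [this, zero_add]
    suffices htop : ⊤ ≤ LinearMap.ker ((ad R _ a).restrictScalars ℂ ∘ₗ TensorProduct.mk ℂ R 𝔤 1)
      from eq_zero_of_forall_lie_one_tmul fun x => htop (Submodule.mem_top (x := x))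
    rw [← iSup_gradedPiece Δ]
    exact iSup_le hcomm

section BorelPoint

variable {φ : LinearMap.GeneralLinearGroup R (R ⊗[ℂ] 𝔤)} (hφ : φ ∈ points (borelSubgroup Δ) R)
include hφ

lemma map_lie_of_mem_points_borelSubgroup (x y : R ⊗[ℂ] 𝔤) : φ.1 ⁅x, y⁆ = ⁅φ.1 x, φ.1 y⁆ :=
  points_map_lie (fun _ hσ => map_lie_of_mem_adjointGroup (borelSubgroup_le Δ hσ)) hφ x y

lemma map_mem_filtrationExt {k : ℤ} {x : R ⊗[ℂ] 𝔤} (hx : x ∈ filtrationExt Δ R k) :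
    φ.1 x ∈ filtrationExt Δ R k :=
  points_map_mem_baseChange (fun _ hσ _ hx => mem_filtration_of_mem_borelSubgroup Δ hσ hx) hφ hx

lemma map_sub_self_mem_filtrationExt_one {x : R ⊗[ℂ] 𝔤} (hx : x ∈ gradedPieceExt Δ R 0) :
    φ.1 x - x ∈ filtrationExt Δ R 1 := by
  suffices h : gradedPieceExt Δ R 0 ≤ (filtrationExt Δ R 1).comap (φ.1 - LinearMap.id) from h hx
  refine baseChange_le_iff.mpr fun h hh => ?_
  rw [gradedPiece_zero] at hh
  exact points_map_sub_mem (fun _ hσ => map_sub_self_mem_of_mem_borelSubgroup Δ hσ hh) hφ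

lemma map_sub_self_mem_of_lie_injective {d k : ℤ} {p : R ⊗[ℂ] 𝔤} (hp : p ∈ gradedPieceExt Δ R d)
    (hφp : φ.1 p - p ∈ filtrationExt Δ R (d + 1))
    (hinj : ∀ w ∈ gradedPieceExt Δ R k, ⁅p, w⁆ = 0 → w = 0)
    (hdk : ∀ x ∈ gradedPieceExt Δ R (d + k), φ.1 x - x ∈ filtrationExt Δ R (d + k + 1))
    {x : R ⊗[ℂ] 𝔤} (hx : x ∈ gradedPieceExt Δ R k) :
    φ.1 x - x ∈ filtrationExt Δ R (k + 1) := by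
  have hxk := gradedPieceExt_le_filtrationExt le_rfl hx
  have hpd := gradedPieceExt_le_filtrationExt le_rfl hp
  have hφx := map_mem_filtrationExt hφ hxk
  have hmem := sub_mem hφx hxk
  rw [filtrationExt_eq_sup] at hmem
  obtain ⟨w, hw, v, hv, hwv⟩ := Submodule.mem_sup.mp hmem
  have hlie : ⁅p, w⁆ = φ.1 ⁅p, x⁆ - ⁅p, x⁆ - ⁅φ.1 p - p, φ.1 x⁆ - ⁅p, v⁆ := by
    rw [map_lie_of_mem_points_borelSubgroup hφ, eq_sub_of_add_eq hwv, lie_sub, lie_sub, sub_lie]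
    abel
  have hpw : ⁅p, w⁆ = 0 := by
    refine eq_zero_of_mem_gradedPieceExt_of_mem_filtrationExt (l := d + k + 1) (by omega)
      (lie_mem_gradedPieceExt hp hw) ?_
    rw [hlie]
    exact sub_mem (sub_mem (hdk _ (lie_mem_gradedPieceExt hp hx))
      (lie_mem_filtrationExt (by omega) hφp hφx)) (lie_mem_filtrationExt (by omega) hpd hv)
  rw [← hwv, hinj w hw hpw, zero_add]
  exact hv

lemma map_sub_self_mem_of_map_principalF (C : ChevalleyGenerators Δ) (u : Δ.support → Rˣ)
    (hF : φ.1 (C.principalF u) - C.principalF u ∈ filtrationExt Δ R 0) (k : ℤ) :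
    ∀ x ∈ gradedPieceExt Δ R k, φ.1 x - x ∈ filtrationExt Δ R (k + 1) := by
  have hup : ∀ k, 0 ≤ k →
      ∀ x ∈ gradedPieceExt Δ R k, φ.1 x - x ∈ filtrationExt Δ R (k + 1) := by
    intro k hk
    induction k, hk using Int.leInduction with
    | base => exact fun _ => map_sub_self_mem_filtrationExt_one hφ
    | succ k hk ih =>
      refine fun x => map_sub_self_mem_of_lie_injective hφ (C.principalF_mem u) hF
        (fun w => C.eq_zero_of_lie_principalF u (by omega)) ?_
      rwa [neg_add_cancel_comm_assoc]
  rcases le_total 0 k with hk | hk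
  · exact hup k hk
  · induction k, hk using Int.leInductionDown with
    | base => exact hup 0 le_rfl
    | pred k hk ih =>
      have hE := C.principalE_mem u
      refine fun x => map_sub_self_mem_of_lie_injective hφ hE (hup 1 zero_le_one _ hE)
        (fun w => C.eq_zero_of_lie_principalE u (by omega)) ?_
      rwa [add_sub_cancel]

lemma map_sub_self_mem_of_map_gradingElementExt {m : ℤ} (hm : 1 ≤ m)
    (hgr : ∀ k, ∀ x ∈ gradedPieceExt Δ R k, φ.1 x - x ∈ filtrationExt Δ R (k + 1))
    (hρ : φ.1 (gradingElementExt Δ R) - gradingElementExt Δ R ∈ filtrationExt Δ R m)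
    {k : ℤ} {x : R ⊗[ℂ] 𝔤} (hx : x ∈ filtrationExt Δ R k) :
    φ.1 x - x ∈ filtrationExt Δ R (m + k) := by
  suffices h : filtrationExt Δ R k ≤ (filtrationExt Δ R (m + k)).comap (φ.1 - LinearMap.id) from
    h hx
  refine filtrationExt_le_iff.mpr fun r hr x hx =>
    mem_filtrationExt_of_le (k := m + r) (by omega) ?_
  refine mem_filtrationExt_of_lie_sub_mem (j := r) (by omega) (fun i hi _ => by omega)
    (hgr r x hx) ?_
  have hφx := map_mem_filtrationExt hφ (gradedPieceExt_le_filtrationExt le_rfl hx)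
  have hlie : ⁅gradingElementExt Δ R, φ.1 x - x⁆ - (r : R) • (φ.1 x - x) =
      -⁅φ.1 (gradingElementExt Δ R) - gradingElementExt Δ R, φ.1 x⁆ := by
    rw [lie_sub, sub_lie, ← map_lie_of_mem_points_borelSubgroup hφ, lie_gradingElementExt hx,
      map_smul, smul_sub]
    abel
  exact hlie ▸ neg_mem (lie_mem_filtrationExt le_rfl hρ hφx)

lemma map_gradingElementExt_sub_mem_succ (C : ChevalleyGenerators Δ) (u : Δ.support → Rˣ) {m : ℤ}
    (hm : 1 ≤ m) (hρ : φ.1 (gradingElementExt Δ R) - gradingElementExt Δ R ∈ filtrationExt Δ R m)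
    (hF : φ.1 (C.principalF u) - C.principalF u ∈ filtrationExt Δ R m) :
    φ.1 (gradingElementExt Δ R) - gradingElementExt Δ R ∈ filtrationExt Δ R (m + 1) := by
  have hρm := hρ
  rw [filtrationExt_eq_sup] at hρm
  obtain ⟨a, ha, y, hy, hay⟩ := Submodule.mem_sup.mp hρm
  have hFd := C.principalF_mem u
  have hlie : ⁅a, C.principalF u⁆ =
      -(⁅φ.1 (gradingElementExt Δ R), φ.1 (C.principalF u) - C.principalF u⁆ +
        (φ.1 (C.principalF u) - C.principalF u)) - ⁅y, C.principalF u⁆ := by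
    rw [eq_sub_of_add_eq hay, sub_lie, sub_lie, lie_sub, ← map_lie_of_mem_points_borelSubgroup hφ,
      C.lie_gradingElementExt_principalF, map_neg]
    abel
  have hφρ := map_mem_filtrationExt hφ
    (gradedPieceExt_le_filtrationExt le_rfl (gradingElementExt_mem (Δ := Δ) (R := R)))
  have ha0 : a = 0 := by
    refine C.eq_zero_of_lie_principalF u (by omega) ha ?_
    rw [← lie_skew, neg_eq_zero]
    refine eq_zero_of_mem_gradedPieceExt_of_mem_filtrationExt (l := m) (by omega)
      (lie_mem_gradedPieceExt ha hFd) ?_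
    rw [hlie]
    exact sub_mem (neg_mem (add_mem (lie_mem_filtrationExt (by omega) hφρ hF) hF))
      (lie_mem_filtrationExt (by omega) hy (gradedPieceExt_le_filtrationExt le_rfl hFd))
  rw [← hay, ha0, zero_add]
  exact hy

variable {A : R ⊗[ℂ] 𝔤} {D : Derivation ℂ R R}
  (hA : ∀ x, derExt 𝔤 D (φ.1 x) + ⁅A, φ.1 x⁆ = φ.1 (derExt 𝔤 D x + ⁅A, x⁆))
include hA

lemma map_form_sub_mem_of_gauge {m : ℤ}
    (hm : ∀ k, ∀ x ∈ filtrationExt Δ R k, φ.1 x - x ∈ filtrationExt Δ R (m + k)) :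
    φ.1 A - A ∈ filtrationExt Δ R m := by
  have hlie (x : R ⊗[ℂ] 𝔤) : ⁅φ.1 A - A, φ.1 x⁆ =
      derExt 𝔤 D (φ.1 x - x) - (φ.1 (derExt 𝔤 D x) - derExt 𝔤 D x) := by
    have hx := hA x
    rw [map_add, map_lie_of_mem_points_borelSubgroup hφ] at hx
    rw [sub_lie, map_sub, eq_sub_of_add_eq' hx.symm]
    abel
  refine mem_filtrationExt_of_forall_lie_mem fun k y hy => ?_
  have hx : (φ⁻¹).1 y ∈ filtrationExt Δ R k := map_mem_filtrationExt (inv_mem hφ) hy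
  have hy : φ.1 ((φ⁻¹).1 y) = y := LinearMap.congr_fun φ.mul_inv y
  rw [← hy, hlie]
  exact sub_mem (derExt_mem_filtrationExt D (hm k _ hx))
    (hm k _ (derExt_mem_filtrationExt D hx))

theorem eq_one_of_gauge (C : ChevalleyGenerators Δ) (u : Δ.support → Rˣ)
    (hAF : A - C.principalF u ∈ filtrationExt Δ R 0) : φ = 1 := by
  have hF : φ.1 (C.principalF u) - C.principalF u =
      φ.1 A - A - (φ.1 (A - C.principalF u) - (A - C.principalF u)) := by
    rw [map_sub]
    abel
  have hF0 : φ.1 (C.principalF u) - C.principalF u ∈ filtrationExt Δ R 0 := by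
    have hA0 := map_form_sub_mem_of_gauge hφ hA (m := 0) fun k x hx => by
      rw [zero_add]
      exact sub_mem (map_mem_filtrationExt hφ hx) hx
    exact hF ▸ sub_mem hA0 (sub_mem (map_mem_filtrationExt hφ hAF) hAF)
  have hgr := map_sub_self_mem_of_map_principalF hφ C u hF0
  have hρ : ∀ m, 1 ≤ m →
      φ.1 (gradingElementExt Δ R) - gradingElementExt Δ R ∈ filtrationExt Δ R m := by
    intro m hm
    induction m, hm using Int.leInduction with
    | base => exact map_sub_self_mem_filtrationExt_one hφ gradingElementExt_mem
    | succ m hm ih =>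
      have hraise (k : ℤ) (x) (hx : x ∈ filtrationExt Δ R k) :
          φ.1 x - x ∈ filtrationExt Δ R (m + k) :=
        map_sub_self_mem_of_map_gradingElementExt hφ hm hgr ih hx
      refine map_gradingElementExt_sub_mem_succ hφ C u hm ih (hF ▸ sub_mem ?_ ?_)
      · exact map_form_sub_mem_of_gauge hφ hA hraise
      · exact add_zero m ▸ hraise 0 _ hAF
  refine Units.ext (LinearMap.ext fun x => sub_eq_zero.mp ?_)
  obtain ⟨N, hN⟩ := exists_filtrationExt_eq_top Δ R
  refine eq_zero_of_forall_mem_filtrationExt (Δ := Δ) (l := 1 - (N : ℤ)) fun k hk => ?_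
  have hm : 1 ≤ k + N := by omega
  have hx := map_sub_self_mem_of_map_gradingElementExt hφ hm hgr (hρ _ hm) (k := -N) (x := x)
    (by rw [hN]; exact Submodule.mem_top)
  rwa [add_neg_cancel_right] at hx

end BorelPoint

end Gauge

/-! ### Rigidity of opers -/

section RootComponents

open LieAlgebra

variable {𝔤 : Type*} [LieRing 𝔤] [LieAlgebra ℂ 𝔤] [FiniteDimensional ℂ 𝔤]
  {H : LieSubalgebra ℂ 𝔤} [H.IsCartanSubalgebra] {R : Type*} [CommRing R] [Algebra ℂ R]

lemma rootProj_baseChange_of_mem {χ : H → ℂ} {x : R ⊗[ℂ] 𝔤}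
    (hx : x ∈ (rootSpace H χ).toSubmodule.baseChange R) : (rootProj H χ).baseChange R x = x := by
  suffices h : (rootSpace H χ).toSubmodule.baseChange R ≤
      LinearMap.eqLocus ((rootProj H χ).baseChange R) LinearMap.id from h hx
  refine baseChange_le_iff.mpr fun y hy => ?_
  rw [LinearMap.mem_eqLocus, LinearMap.baseChange_tmul, rootProj_apply_of_mem hy,
    LinearMap.id_apply]

variable [LieAlgebra.IsSemisimple ℂ 𝔤] {Δ : (LieAlgebra.IsKilling.rootSystem H).Base}

lemma filtrationExt_zero_le_ker_rootProj_baseChange (i : Δ.support) :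
    filtrationExt Δ R 0 ≤ LinearMap.ker ((rootProj H ⇑(-simpleRoot Δ i)).baseChange R) := by
  refine baseChange_le_iff.mpr fun y hy => ?_
  rw [LinearMap.mem_ker, LinearMap.baseChange_tmul,
    LinearMap.mem_ker.mp (filtration_zero_le_ker_rootProj Δ i hy), TensorProduct.tmul_zero]

lemma sub_rootProj_baseChange_mem (i : Δ.support) {x : R ⊗[ℂ] 𝔤}
    (hx : x ∈ ((rootSpace H ⇑(-simpleRoot Δ i)).toSubmodule ⊔ filtration Δ 0).baseChange R) :
    x - (rootProj H ⇑(-simpleRoot Δ i)).baseChange R x ∈ filtrationExt Δ R 0 := by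
  rw [baseChange_sup] at hx
  obtain ⟨y, hy, z, hz, rfl⟩ := Submodule.mem_sup.mp hx
  rw [map_add, rootProj_baseChange_of_mem hy,
    LinearMap.mem_ker.mp (filtrationExt_zero_le_ker_rootProj_baseChange i hz), add_zero,
    add_sub_cancel_left]
  exact hz

lemma rootProj_map_of_mem_points_borelSubgroup {φ : LinearMap.GeneralLinearGroup R (R ⊗[ℂ] 𝔤)}
    (hφ : φ ∈ points (borelSubgroup Δ) R) (i : Δ.support) {x : R ⊗[ℂ] 𝔤}
    (hx : x ∈ ((rootSpace H ⇑(-simpleRoot Δ i)).toSubmodule ⊔ filtration Δ 0).baseChange R) :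
    (rootProj H ⇑(-simpleRoot Δ i)).baseChange R (φ.1 x) =
      (rootProj H ⇑(-simpleRoot Δ i)).baseChange R
        (φ.1 ((rootProj H ⇑(-simpleRoot Δ i)).baseChange R x)) := by
  rw [← sub_eq_zero, ← map_sub, ← map_sub]
  exact filtrationExt_zero_le_ker_rootProj_baseChange i
    (map_mem_filtrationExt hφ (sub_rootProj_baseChange_mem i hx))

namespace ChevalleyGenerators

variable (C : ChevalleyGenerators Δ)

lemma exists_eq_tmul_f (i : Δ.support) {x : R ⊗[ℂ] 𝔤}
    (hx : x ∈ (rootSpace H ⇑(-simpleRoot Δ i)).toSubmodule.baseChange R) :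
    ∃ r : R, x = r ⊗ₜ C.f i := by
  rw [C.rootSpace_neg_eq_span, Submodule.baseChange_span, Set.image_singleton] at hx
  obtain ⟨r, rfl⟩ := Submodule.mem_span_singleton.mp hx
  exact ⟨r, (TensorProduct.tmul_eq_smul_one_tmul r (C.f i)).symm⟩

lemma sub_principalF_mem {A : R ⊗[ℂ] 𝔤} (hA : A ∈ filtrationExt Δ R (-1)) {u : Δ.support → Rˣ}
    (hu : ∀ i, (rootProj H ⇑(-simpleRoot Δ i)).baseChange R A = (u i : R) ⊗ₜ C.f i) :
    A - C.principalF u ∈ filtrationExt Δ R 0 := by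
  have hsum : (LinearMap.id - ∑ i, rootProj H ⇑(-simpleRoot Δ i)).baseChange R A =
      A - C.principalF u := by
    simp only [← LinearMap.baseChangeHom_apply, map_sub, map_sum]
    simp only [LinearMap.baseChangeHom_apply, LinearMap.baseChange_id, LinearMap.sub_apply,
      LinearMap.id_apply, LinearMap.sum_apply, hu, principalF]
  rw [← hsum]
  exact baseChange_apply_mem
    (fun x hx => by simpa using sub_sum_rootProj_mem_filtration Δ hx) hA

end ChevalleyGenerators

end RootComponents

section Rigidity

open LieAlgebra

universe w u

variable {X : TopCat.{0}} {O : TopCat.Presheaf (CommAlgCat.{0} ℂ) X}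

lemma resO_self {U : Opens X} (f : O.obj (op U)) : resO O (le_refl U) f = f := by
  have h : O.map (homOfLE (le_refl U)).op = 𝟙 _ := O.map_id (op U)
  rw [resO, h]
  rfl

lemma extMap_resO_self {𝔤 : Type u} [AddCommGroup 𝔤] [Module ℂ 𝔤] {U : Opens X}
    (y : O.obj (op U) ⊗[ℂ] 𝔤) : extMap 𝔤 (resO O (le_refl U)) y = y := by
  induction y with
  | zero => simp
  | tmul a x => rw [extMap_tmul, resO_self]
  | add y z hy hz => rw [map_add, hy, hz]

lemma extMap_resO_resO {𝔤 : Type u} [AddCommGroup 𝔤] [Module ℂ 𝔤] {U V W : Opens X}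
    (hV : V ≤ U) (hW : W ≤ V) (y : O.obj (op U) ⊗[ℂ] 𝔤) :
    extMap 𝔤 (resO O hW) (extMap 𝔤 (resO O hV) y) = extMap 𝔤 (resO O (hW.trans hV)) y := by
  induction y with
  | zero => simp
  | tmul a x => simp only [extMap_tmul, VectorField.resO_resO]
  | add y z hy hz => simp only [map_add, hy, hz]

variable {𝔤 : Type u} [LieRing 𝔤] [LieAlgebra ℂ 𝔤] [FiniteDimensional ℂ 𝔤]

namespace PrincipalBundle

variable {S T : Subgroup (LinearMap.GeneralLinearGroup ℂ 𝔤)} (F : PrincipalBundle.{w} O S)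

lemma div_self {U : Opens X} (s : F.sec U) : F.div s s = 1 :=
  (F.eq_div (F.act_one s)).symm

lemma div_act {U : Opens X} (s t : F.sec U) (b : points S (O.obj (op U))) :
    F.div s (F.act t b) = F.div s t * b := by
  refine (F.eq_div ?_).symm
  rw [F.act_mul, F.act_div]

lemma div_res {U V : Opens X} (h : V ≤ U) (s t : F.sec U) :
    F.div (F.res h s) (F.res h t) = pointsExt S (resO O h) (F.div s t) := by
  refine (F.eq_div ?_).symm
  rw [← F.res_act, F.act_div]

lemma toInduced_act (hST : S ≤ T) {U : Opens X} (s : F.sec U) (b : points S (O.obj (op U))) :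
    F.toInduced hST (F.act s b) =
      (F.induced hST).act (F.toInduced hST s) (Subgroup.inclusion (points_mono hST _) b) := by
  refine GSpace.InducedSec.ext ?_
  funext V hV t
  change Subgroup.inclusion (points_mono hST _) (F.div t (F.res hV (F.act s b))) =
    Subgroup.inclusion (points_mono hST _) (F.div t (F.res hV s)) *
      pointsExt T (resO O hV) (Subgroup.inclusion (points_mono hST _) b)
  rw [F.res_act, div_act, map_mul]
  rfl

lemma Iso.mapInduced_toInduced {F F' : PrincipalBundle.{w} O S} (f : Iso F F') (hST : S ≤ T)
    {U : Opens X} (s : F.sec U) :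
    f.mapInduced hST (F.toInduced hST s) = F'.toInduced hST (f.toEquiv U s) := by
  refine GSpace.InducedSec.ext ?_
  funext V hV t
  change Subgroup.inclusion (points_mono hST _) (F.div ((f.toEquiv V).symm t) (F.res hV s)) =
    Subgroup.inclusion (points_mono hST _) (F'.div t (F'.res hV (f.toEquiv U s)))
  congr 1
  refine F'.eq_div ?_
  rw [← f.map_res, ← F.act_div ((f.toEquiv V).symm t) (F.res hV s), f.map_act,
    Equiv.apply_symm_apply, F.act_div]

end PrincipalBundle

variable [LieAlgebra.IsSemisimple ℂ 𝔤] {H : LieSubalgebra ℂ 𝔤} [H.IsCartanSubalgebra]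
  {Δ : (LieAlgebra.IsKilling.rootSystem H).Base}

section RootTwist

variable (F : PrincipalBundle.{w} O (borelSubgroup Δ)) (i : Δ.support)

/-- The section of `𝔤^{-α}_F` over `U` whose value at the section `s` of `F` is `x ∈ 𝔤^{-α}`. -/
def twistSection {U : Opens X} (s : F.sec U) (x : O.obj (op U) ⊗[ℂ] 𝔤) :
    ∀ V : Opens X, V ≤ U → F.sec V → O.obj (op V) ⊗[ℂ] 𝔤 :=
  fun V hV t => (rootProj H ⇑(-simpleRoot Δ i)).baseChange (O.obj (op V))
    ((F.div (F.res hV s) t)⁻¹.1.1 (extMap 𝔤 (resO O hV) x))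

lemma twistSection_mem_rootTwist {U : Opens X} (s : F.sec U) {x : O.obj (op U) ⊗[ℂ] 𝔤}
    (hx : x ∈ (rootSpace H ⇑(-simpleRoot Δ i)).toSubmodule.baseChange (O.obj (op U))) :
    twistSection F i s x ∈ rootTwist F i U := by
  refine ⟨fun V hV t => baseChange_apply_mem (W := ⊤) (fun y _ => rootProj_mem _ y) (by simp),
    fun V W hV hW t => ?_, fun V hV t b => ?_⟩
  · rw [twistSection, twistSection, extMap_baseChange, ← F.res_res hV hW, F.div_res, ← map_inv,
      ← extMap_resO_resO hV hW]
    congr 1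
    exact endExt_extMap _ _ _
  · rw [twistSection, twistSection, F.div_act, mul_inv_rev]
    exact rootProj_map_of_mem_points_borelSubgroup b⁻¹.2 i <| points_map_mem_baseChange
      (fun _ hσ _ hy => map_neg_simpleRoot_of_mem_borelSubgroup Δ hσ i hy)
      (F.div (F.res hV s) t)⁻¹.2 (rTensor_mem_baseChange (resO O hV).toLinearMap hx)

lemma twistSection_self {U : Opens X} (s : F.sec U) {x : O.obj (op U) ⊗[ℂ] 𝔤}
    (hx : x ∈ (rootSpace H ⇑(-simpleRoot Δ i)).toSubmodule.baseChange (O.obj (op U))) :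
    twistSection F i s x U le_rfl s = x := by
  rw [twistSection, F.res_self, F.div_self, extMap_resO_self, inv_one]
  exact rootProj_baseChange_of_mem hx

variable {F i} in
lemma rootTwist_ext {U : Opens X} (s : F.sec U)
    {v v' : ∀ V : Opens X, V ≤ U → F.sec V → O.obj (op V) ⊗[ℂ] 𝔤}
    (hv : v ∈ rootTwist F i U) (hv' : v' ∈ rootTwist F i U)
    (h : v U le_rfl s = v' U le_rfl s) : v = v' := by
  funext V hV t
  rw [← F.act_div (F.res hV s) t, hv.2.2, hv'.2.2, hv.2.1 U V le_rfl hV, hv'.2.1 U V le_rfl hV, h]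

end RootTwist

namespace Oper

variable (E : Oper.{w} O Δ) {U : Opens X} (s : E.bundle.sec U)

/-- The function `A` for which `∇_θ = θ + A` in the trivialization given by `s`. -/
def connectionForm (θ : VectorField O U) : O.obj (op U) ⊗[ℂ] 𝔤 :=
  (E.conn.nabla θ).form U le_rfl (E.bundle.toInduced (borelSubgroup_le Δ) s)

/-- The component in `𝔤^{-α}` of the function `A` for which `∇_θ = θ + A` in the trivialization
given by `s`. -/
def simpleComponent (i : Δ.support) (θ : VectorField O U) : O.obj (op U) ⊗[ℂ] 𝔤 :=
  (rootProj H ⇑(-simpleRoot Δ i)).baseChange _ (E.connectionForm s θ)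

lemma simpleComponent_smul (i : Δ.support) (r : O.obj (op U)) (θ : VectorField O U) :
    E.simpleComponent s i (r • θ) = r • E.simpleComponent s i θ := by
  rw [simpleComponent, connectionForm, E.conn.nabla_smul, resO_self, map_smul]
  rfl

lemma bijOn_simpleComponent (i : Δ.support) : Set.BijOn (E.simpleComponent s i) Set.univ
    ((rootSpace H ⇑(-simpleRoot Δ i)).toSubmodule.baseChange (O.obj (op U))) := by
  have hE := E.bijective i U
  refine ⟨fun θ hθ => (hE.mapsTo hθ).1 U le_rfl s, fun θ hθ η hη h => ?_, fun x hx => ?_⟩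
  · exact hE.injOn hθ hη (rootTwist_ext s (hE.mapsTo hθ) (hE.mapsTo hη) h)
  · obtain ⟨θ, hθ, hθx⟩ := hE.surjOn (twistSection_mem_rootTwist E.bundle i s hx)
    refine ⟨θ, hθ, ?_⟩
    have hθs : E.simpleComponent s i θ = twistSection E.bundle i s x U le_rfl s :=
      congrFun (congrFun (congrFun hθx U) le_rfl) s
    rw [hθs, twistSection_self E.bundle i s hx]

lemma exists_forall_simpleComponent_eq (C : ChevalleyGenerators Δ) :
    ∃ (θ : VectorField O U) (u : Δ.support → (O.obj (op U))ˣ),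
      ∀ i, E.simpleComponent s i θ = (u i : O.obj (op U)) ⊗ₜ C.f i := by
  rcases isEmpty_or_nonempty Δ.support with hΔ | ⟨⟨i₀⟩⟩
  · exact ⟨⟨fun _ _ => 0, fun _ _ _ _ _ => by simp⟩, 1, hΔ.elim⟩
  have hgen (i) : ∃ η, E.simpleComponent s i η = 1 ⊗ₜ C.f i := by
    obtain ⟨η, -, hη⟩ := (E.bijOn_simpleComponent s i).surjOn
      (Submodule.tmul_mem_baseChange_of_mem 1 (C.f_mem i))
    exact ⟨η, hη⟩
  have hcoeff (i) (θ) : ∃ r : O.obj (op U), E.simpleComponent s i θ = r ⊗ₜ C.f i :=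
    C.exists_eq_tmul_f i ((E.bijOn_simpleComponent s i).mapsTo (Set.mem_univ θ))
  choose η hη using hgen
  choose r hr using fun i => hcoeff i (η i₀)
  choose q hq using fun i => hcoeff i₀ (η i)
  have hη₀ (i) : η i = q i • η i₀ := by
    refine (E.bijOn_simpleComponent s i₀).injOn (Set.mem_univ _) (Set.mem_univ _) ?_
    rw [simpleComponent_smul, hη, hq, ← TensorProduct.tmul_eq_smul_one_tmul]
  have hqr (i) : q i * r i = 1 := by
    have h1 := hη i
    rw [hη₀ i, simpleComponent_smul, hr, TensorProduct.smul_tmul', smul_eq_mul] at h1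
    refine sub_eq_zero.mp (eq_zero_of_smul_one_tmul_eq_zero (C.f_ne_zero i) ?_)
    rw [← TensorProduct.tmul_eq_smul_one_tmul, TensorProduct.sub_tmul, h1, sub_self]
  exact ⟨η i₀, fun i => ⟨r i, q i, by rw [mul_comm, hqr], hqr i⟩, hr⟩

variable {E}

lemma Iso.gauge_connectionForm (φ : Iso E E) (θ : VectorField O U) (y : O.obj (op U) ⊗[ℂ] 𝔤) :
    derExt 𝔤 (θ.der U le_rfl) ((E.bundle.div s (φ.toEquiv U s)).1.1 y) +
        ⁅E.connectionForm s θ, (E.bundle.div s (φ.toEquiv U s)).1.1 y⁆ =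
      (E.bundle.div s (φ.toEquiv U s)).1.1
        (derExt 𝔤 (θ.der U le_rfl) y + ⁅E.connectionForm s θ, y⁆) := by
  set b := E.bundle.div s (φ.toEquiv U s)
  set p := E.bundle.toInduced (borelSubgroup_le Δ) s
  set k := Subgroup.inclusion (points_mono (borelSubgroup_le Δ) _) b
  have hpres : (E.conn.nabla θ).form U le_rfl ((gBundle E.bundle).act p k) =
      E.connectionForm s θ := by
    have h := φ.map_conn θ U le_rfl p
    rwa [PrincipalBundle.Iso.mapInduced_toInduced, ← E.bundle.act_div s (φ.toEquiv U s),
      PrincipalBundle.toInduced_act] at h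
  have hgauge := (E.conn.nabla θ).gauge U le_rfl p k y
  rw [hpres, E.conn.anchor_nabla] at hgauge
  rw [hgauge]
  exact (LinearMap.congr_fun b.1.mul_inv _).symm

lemma Iso.toEquiv_apply_eq (φ : Iso E E) : φ.toEquiv U s = s := by
  obtain ⟨C⟩ := nonempty_chevalleyGenerators Δ
  obtain ⟨θ, u, hu⟩ := E.exists_forall_simpleComponent_eq s C
  have hdiv : E.bundle.div s (φ.toEquiv U s) = 1 := Subtype.ext <|
    eq_one_of_gauge (E.bundle.div s (φ.toEquiv U s)).2 (φ.gauge_connectionForm s θ) C u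
      (C.sub_principalF_mem (E.nabla_mem θ U le_rfl s) hu)
  rw [← E.bundle.act_div s (φ.toEquiv U s), hdiv, E.bundle.act_one]

end Oper

end Rigidity

end

end Opers

theorem proposition1p3_general {X : TopCat.{0}} {O : TopCat.Presheaf (CommAlgCat.{0} ℂ) X}
    {𝔤 : Type*} [LieRing 𝔤] [LieAlgebra ℂ 𝔤] [FiniteDimensional ℂ 𝔤]
    [LieAlgebra.IsSemisimple ℂ 𝔤] {H : LieSubalgebra ℂ 𝔤} [H.IsCartanSubalgebra]
    {Δ : (LieAlgebra.IsKilling.rootSystem H).Base} {E : Opers.Oper O Δ}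
    (φ : Opers.Oper.Iso E E) : φ = Opers.Oper.Iso.refl E :=
  Opers.Oper.Iso.ext (funext fun _ => Equiv.ext fun s => φ.toEquiv_apply_eq s)

/-- A `𝔤`-oper on a smooth algebraic curve `Y` over `ℂ` has no nontrivial automorphisms. -/
theorem proposition1p3 {𝔤 : Type*} [LieRing 𝔤] [LieAlgebra ℂ 𝔤] [FiniteDimensional ℂ 𝔤]
    [LieAlgebra.IsSemisimple ℂ 𝔤] (H : LieSubalgebra ℂ 𝔤) [H.IsCartanSubalgebra]
    (Δ : (LieAlgebra.IsKilling.rootSystem H).Base)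
    (Y : Scheme.{0}) (π : Y ⟶ Spec (CommRingCat.of ℂ)) [SmoothOfRelativeDimension 1 π]
    (E : Opers.Oper (Opers.structureSheaf π) Δ) (φ : Opers.Oper.Iso E E) :
    φ = Opers.Oper.Iso.refl E :=
  proposition1p3_general φ
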